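/- **Setup.** A partition is a sequence $\lambda=(\lambda_1\ge\lambda_2\ge\dots\ge 0)$ of integers with finitely many nonzero terms; $l(\lambda)$ is the number of nonzero terms. Write $(x;q)_m=\prod_{i=1}^{m}(1-xq^{i-1})$. Let $n\ge 0$, let $q\in\mathbb C$ and let $\Xi=(\xi_0,\xi_1,\dots)$, ${\sf S}=(s_0,s_1,\dots)$ be sequences of nonzero complex numbers with fixed square roots $\sqrt{\xi_i},\sqrt{s_i}$. For $i,k\ge 0$ put $s^{(k)}_i=\sqrt{s_{i+k}}\sqrt{\xi_{i+k}}\sqrt{s_i}/\sqrt{\xi_i}$ (so $s_i^{(0)}=s_i$) and $\tau^k_\Xi{\sf S}=(s^{(k)}_0,s^{(k)}_1,\dots)$. Assume that the parameters are generic in the sense that no denominator below vanishes: $q^m\ne1$ for all $m\ge1$, and $(s_i^{(k)})^2q^m\neq 1$ for all $i\ge1$, $0\le k\le n$, $m\ge0$. For $i,j,k,l\in\mathbb Z_{\ge0}$ (labels of the bottom, left, top and right edge of a vertex) let $$W_{t,s}(i,j;k,l)=\mathbf 1_{i+j=k+l}\,\mathbf 1_{i\ge l}\;s^{2l}t^{-2l}\,\frac{(s^2/t^2;q)_{i-l}\,(t^2;q)_l}{(s^2;q)_i}\,\frac{(q;q)_i}{(q;q)_{i-l}(q;q)_l}.$$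 Let $\lambda,\mu$ be partitions and $\kappa_1,\dots,\kappa_n$ nonzero complex variables. Consider a grid with $n$ rows (numbered $1,\dots,n$ from top to bottom) and $L$ columns (numbered $1,\dots,L$ from left to right), where $L=\max(l(\lambda),l(\mu))+1$ (the value below is the same for all larger $L$). The vertex in row $i$ and column $j$ has weight $W_{t,s}$ with $t=\sqrt{\xi_{i+j}s_{i+j}/\kappa_i}$ and $s=s^{(i)}_j$ (only $t^2$ and $s^2$ matter). For $a\in\mathbb Z_{\ge0}^n$ let $ZW^{(a_1,\dots,a_n)}_{\lambda/\mu}(\kappa_1,\dots,\kappa_n)$ be the sum, over all labelings of the edges by nonnegative integers such that the left edge of row $i$ has label $a_i$, all right boundary edges have label $0$, the bottom edge of column $j$ has label $\mu_j-\mu_{j+1}$ and the top edge of column $j$ has label $\lambda_j-\lambda_{j+1}$, of the product of the weights of all vertices; only finitely many terms are nonzero. Set $$\mathbb F^{\sf s}_{\lambda/\mu}(\kappa_1,\dots,\kappa_n\mid\Xi,{\sf S})=\sum_{\substack{a\in\mathbb Z_{\ge0}^n\\ a_1+\dots+a_n=\lambda_1-\mu_1}}\ \prod_{i=1}^n\Big(\frac{\kappa_is_0}{\xi_0}\Big)^{a_i}\frac{(\kappa_i^{-1}s_i\xi_i;q)_{a_i}}{(q;q)_{a_i}}\;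 ZW^{(a_1,\dots,a_n)}_{\lambda/\mu}(\kappa_1,\dots,\kappa_n),$$ $$\mathbb F_{\lambda/\mu}(\kappa_1,\dots,\kappa_n\mid\Xi,{\sf S})=\frac{(-\tau^n_\Xi{\sf S})^{\mu}}{(-{\sf S})^{\lambda}}\,\frac{{\sf c}_{\tau^n_\Xi{\sf S}}(\mu)}{{\sf c}_{\sf S}(\lambda)}\,\mathbb F^{\sf s}_{\lambda/\mu}(\kappa_1,\dots,\kappa_n\mid\Xi,{\sf S}),$$ where ${\sf c}_{\sf S}(\lambda)=\prod_{i\ge1}\frac{(s_i^2;q)_{\lambda_i-\lambda_{i+1}}}{(q;q)_{\lambda_i-\lambda_{i+1}}}$ and $(-{\sf S})^\lambda=\prod_{i\ge1}(-s_{i-1})^{\lambda_i}$. **Theorem.** For all partitions $\lambda,\mu$, the inhomogeneous spin $q$-Whittaker function $\mathbb F_{\lambda/\mu}(\kappa_1,\dots,\kappa_n\mid\Xi,{\sf S})$ is a symmetric polynomial in $\kappa_1,\dots,\kappa_n$: there is a symmetric polynomial $P\in\mathbb C[x_1,\dots,x_n]$ with $\mathbb F_{\lambda/\mu}(\kappa_1,\dots,\kappa_n\mid\Xi,{\sf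 S})=P(\kappa_1,\dots,\kappa_n)$ for all nonzero $\kappa_1,\dots,\kappa_n$. -/

import Mathlib

namespace SpinQW

/-- A partition `λ₁ ≥ λ₂ ≥ … ≥ 0` with finitely many nonzero parts.
Parts are indexed from `0`: `part i` is `λ_{i+1}`. -/
@[ext]
structure Ptn where
  part : ℕ → ℕ
  antitone_part : Antitone part
  finite_support : (Function.support part).Finite

/-- The length of a partition: the number of its nonzero parts. -/
noncomputable def Ptn.length (lam : Ptn) : ℕ := (Function.support lam.part).ncard

/-- `m_j(λ') = λ_j - λ_{j+1}` for the column `j = c + 1`. The subtraction does not truncate,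
since the parts are nonincreasing. -/
def Ptn.mult (lam : Ptn) (c : ℕ) : ℕ := lam.part c - lam.part (c + 1)

/-- The `q`-Pochhammer symbol `(x; q)_n = ∏_{i=1}^n (1 - x q^{i-1})`. -/
noncomputable def qPoch (x q : ℂ) (n : ℕ) : ℂ := ∏ i ∈ Finset.range n, (1 - x * q ^ i)

/-- The `q`-Hahn vertex weight `W_{t,s}(i, j; k, l)`, where `i`, `j`, `k`, `l` are the labels of
the bottom, left, top and right edge. -/
noncomputable def weight (q t s : ℂ) (i j k l : ℕ) : ℂ :=
  if i + j = k + l ∧ l ≤ i then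
    s ^ (2 * l) * (t ^ (2 * l))⁻¹
      * (qPoch (s ^ 2 / t ^ 2) q (i - l) * qPoch (t ^ 2) q l / qPoch (s ^ 2) q i)
      * (qPoch q q i / (qPoch q q (i - l) * qPoch q q l))
  else 0

/-- The mixed shift `τ^k_B A`, with entries `√(a_{i+k} b_{i+k} a_i / b_i)`. The arguments are
fixed square roots `ra i = √a_i` and `rb i = √b_i` of the entries of `A` and `B`. -/
noncomputable def mixedShift (ra rb : ℕ → ℂ) (k i : ℕ) : ℂ :=
  ra (i + k) * rb (i + k) * ra i / rb i

/-- `c_S(λ) = ∏_{i ≥ 1} (s_i²; q)_{λ_i - λ_{i+1}} / (q; q)_{λ_i - λ_{i+1}}`; the factors with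
`i > l(λ)` equal `1`. -/
noncomputable def cFactor (q : ℂ) (s : ℕ → ℂ) (lam : Ptn) : ℂ :=
  ∏ c ∈ Finset.range lam.length,
    qPoch (s (c + 1) ^ 2) q (lam.mult c) / qPoch q q (lam.mult c)

/-- `(-S)^λ = ∏_{i ≥ 1} (-s_{i-1})^{λ_i}`. -/
noncomputable def negPow (s : ℕ → ℂ) (lam : Ptn) : ℂ :=
  ∏ c ∈ Finset.range lam.length, (-s c) ^ lam.part c

/-- An assignment of labels to the edges of a grid with `n` rows, numbered from top to bottom,
and `L` columns, numbered from left to right.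
In row `r`, `hor r 0` is the left incoming edge, `hor r c.castSucc` and `hor r c.succ` are the
edges to the left and to the right of the vertex in column `c`.
In column `c`, `ver 0 c` is the top edge, `ver r.castSucc c` and `ver r.succ c` are the edges
above and below the vertex in row `r`, and `ver (Fin.last n) c` is the bottom edge. -/
@[ext]
structure Config (n L : ℕ) where
  hor : Fin n → Fin (L + 1) → ℕ
  ver : Fin (n + 1) → Fin L → ℕ

/-- The boundary conditions: left labels `a_r`, right labels `0`, top labels `m_c(λ')` and
bottom labels `m_c(μ')`. -/
structure Config.HasBoundary {n L : ℕ} (C : Config n L) (a : Fin n → ℕ) (lam mu : Ptn) :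
    Prop where
  left : ∀ r, C.hor r 0 = a r
  right : ∀ r, C.hor r (Fin.last L) = 0
  top : ∀ c, C.ver 0 c = lam.mult c
  bottom : ∀ c, C.ver (Fin.last n) c = mu.mult c

/-- The weight of a configuration: the product of the weights of its vertices. The vertex in the
`i`-th row and the `j`-th column (counted from `1`, so `i = r + 1` and `j = c + 1`) has
`t = √(ξ_{i+j} s_{i+j} / κ_i)` and `s = s^{(i)}_j = √(s_{i+j} ξ_{i+j} s_j / ξ_j)`. Here `rxi`
and `rs` are square roots of `xi` and `s`. -/
noncomputable def Config.totalWeight {n L : ℕ} (C : Config n L) (q : ℂ)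
    (xi s rxi rs : ℕ → ℂ) (kappa : Fin n → ℂ) : ℂ :=
  ∏ r : Fin n, ∏ c : Fin L,
    weight q
      (Complex.sqrt (xi ((r + 1) + (c + 1)) * s ((r + 1) + (c + 1)) / kappa r))
      (mixedShift rs rxi (r + 1) (c + 1))
      (C.ver r.succ c) (C.hor r c.castSucc) (C.ver r.castSucc c) (C.hor r c.succ)

/-- The partition function `ZW^{(a_1,…,a_n)}_{λ/μ}` of the grid with `n` rows and `L` columns:
the sum of the weights of all configurations with the given boundary conditions. -/
noncomputable def partitionFunction (q : ℂ) (xi s rxi rs : ℕ → ℂ) {n : ℕ} (L : ℕ)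
    (a : Fin n → ℕ) (lam mu : Ptn) (kappa : Fin n → ℂ) : ℂ :=
  ∑ᶠ (C : Config n L) (_ : C.HasBoundary a lam mu), C.totalWeight q xi s rxi rs kappa

/-- The conservation law along a row: the labels entering from the left and from below in the
first `m` columns equal the labels leaving at the top and to the right. -/
theorem row_conservation {L : ℕ} (h : Fin (L + 1) → ℕ) (u d : Fin L → ℕ)
    (hc : ∀ c : Fin L, d c + h c.castSucc = u c + h c.succ) (m : Fin (L + 1)) :
    h 0 + ∑ c : Fin L with c.castSucc < m, d c =
      h m + ∑ c : Fin L with c.castSucc < m, u c := by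
  induction m using Fin.induction with
  | zero => simp
  | succ m ih =>
    have e : (Finset.univ.filter fun c : Fin L => c.castSucc < m.succ) =
        insert m (Finset.univ.filter fun c : Fin L => c.castSucc < m.castSucc) := by
      ext c
      simp only [Finset.mem_filter, Finset.mem_univ, true_and, Finset.mem_insert,
        Fin.lt_def, Fin.val_castSucc, Fin.val_succ, Fin.ext_iff]
      omega
    rw [e, Finset.sum_insert (by simp), Finset.sum_insert (by simp)]
    have := hc m
    omega

/-- Only finitely many configurations contribute to the partition function. -/
theorem finite_config (q : ℂ) (xi s rxi rs : ℕ → ℂ) {n : ℕ} (L : ℕ)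
    (a : Fin n → ℕ) (lam mu : Ptn) (kappa : Fin n → ℂ) :
    {C : Config n L | C.HasBoundary a lam mu ∧
      C.totalWeight q xi s rxi rs kappa ≠ 0}.Finite := by
  classical
  set N := ∑ r, a r + ∑ c : Fin L, mu.mult c with hN
  have key : ∀ C : Config n L, C.HasBoundary a lam mu →
      C.totalWeight q xi s rxi rs kappa ≠ 0 →
      (∀ r c, C.hor r c ≤ N) ∧ ∀ r c, C.ver r c ≤ N := by
    intro C hb hw
    have hc : ∀ r c, C.ver r.succ c + C.hor r c.castSucc =
        C.ver r.castSucc c + C.hor r c.succ := by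
      intro r c
      by_contra hne
      apply hw
      refine Finset.prod_eq_zero (Finset.mem_univ r) (Finset.prod_eq_zero (Finset.mem_univ c) ?_)
      simp [weight, hne]
    have hrow := fun r => row_conservation (C.hor r) (C.ver r.castSucc) (C.ver r.succ) (hc r)
    have hlast : ∀ r, a r + ∑ c, C.ver r.succ c = ∑ c, C.ver r.castSucc c := by
      intro r
      have := hrow r (Fin.last L)
      simpa [hb.left, hb.right, Fin.castSucc_lt_last] using this
    have hv : ∀ r : Fin (n + 1), ∑ c, C.ver r c +
        ∑ r' : Fin n with r'.castSucc < r, a r' = N := by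
      intro r
      induction r using Fin.reverseInduction with
      | last => simp [hb.bottom, Fin.castSucc_lt_last, hN, add_comm]
      | cast r ih =>
        have e : (Finset.univ.filter fun c : Fin n => c.castSucc < r.succ) =
            insert r (Finset.univ.filter fun c : Fin n => c.castSucc < r.castSucc) := by
          ext c
          simp only [Finset.mem_filter, Finset.mem_univ, true_and, Finset.mem_insert,
            Fin.lt_def, Fin.val_castSucc, Fin.val_succ, Fin.ext_iff]
          omega
        rw [e, Finset.sum_insert (by simp)] at ih
        have := hlast r
        omega
    refine ⟨fun r c => ?_, fun r c => ?_⟩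
    · have h1 := hrow r c
      have h2 : ∑ c' : Fin L with c'.castSucc < c, C.ver r.succ c' ≤ ∑ c', C.ver r.succ c' :=
        Finset.sum_le_sum_of_subset (Finset.filter_subset _ _)
      have h3 := hlast r
      have h4 := hv r.castSucc
      have h5 := hb.left r
      omega
    · have h1 : C.ver r c ≤ ∑ c', C.ver r c' :=
        Finset.single_le_sum (f := C.ver r) (fun _ _ => Nat.zero_le _) (Finset.mem_univ c)
      have h2 := hv r
      omega
  have hfin : (Set.univ.pi (fun _ : Fin n => Set.univ.pi fun _ : Fin (L + 1) => Set.Iic N) ×ˢ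
      Set.univ.pi (fun _ : Fin (n + 1) => Set.univ.pi fun _ : Fin L => Set.Iic N)).Finite :=
    (Set.Finite.pi fun _ => Set.Finite.pi fun _ => Set.finite_Iic N).prod
      (Set.Finite.pi fun _ => Set.Finite.pi fun _ => Set.finite_Iic N)
  refine (hfin.image fun p => (⟨p.1, p.2⟩ : Config n L)).subset ?_
  rintro C ⟨hb, hw⟩
  obtain ⟨h1, h2⟩ := key C hb hw
  exact ⟨(C.hor, C.ver), ⟨fun r _ c _ => h1 r c, fun r _ c _ => h2 r c⟩, rfl⟩

/-- The function `F^s_{λ/μ}(κ_1,…,κ_n | Ξ, S)`: the sum over all `a_1,…,a_n ≥ 0` such that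
`a_1 + … + a_n = λ_1 - μ_1` (an empty sum if `λ_1 < μ_1`). The grid has
`L = max (l(λ), l(μ)) + 1` columns. -/
noncomputable def stochWhittaker (q : ℂ) (xi s rxi rs : ℕ → ℂ) {n : ℕ} (lam mu : Ptn)
    (kappa : Fin n → ℂ) : ℂ :=
  ∑ a ∈ Fintype.piFinset (fun _ : Fin n => Finset.range (lam.part 0 + 1)) with
      ∑ r, a r + mu.part 0 = lam.part 0,
    (∏ r : Fin n, (kappa r * s 0 / xi 0) ^ a r
        * (qPoch ((kappa r)⁻¹ * s (r + 1) * xi (r + 1)) q (a r) / qPoch q q (a r)))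
      * partitionFunction q xi s rxi rs (max lam.length mu.length + 1) a lam mu kappa

/-- The inhomogeneous spin `q`-Whittaker function `F_{λ/μ}(κ_1,…,κ_n | Ξ, S)`. -/
noncomputable def spinWhittaker (q : ℂ) (xi s rxi rs : ℕ → ℂ) {n : ℕ} (lam mu : Ptn)
    (kappa : Fin n → ℂ) : ℂ :=
  negPow (mixedShift rs rxi n) mu / negPow s lam
    * (cFactor q (mixedShift rs rxi n) mu / cFactor q s lam)
    * stochWhittaker q xi s rxi rs lam mu kappa

end SpinQW

namespace SpinQW

/-! Put `e r = ξ_{r+1} s_{r+1}`, let `α_c = s_{c+1} / ξ_{c+1}` belong to column `c` (rows and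
columns counted from `0`), and `α₀ = s_0 / ξ_0` to the left boundary. The vertex in row `r` and
column `c` has `t² = e(r+c+1) / κ_r` and `s² = e(r+c+1) α_c`. Attaching a factor to each vertical
edge makes every vertex weight polynomial in `κ` (`weight_mul_gauge`). These factors telescope down
the columns and leave exactly the ratio of the `c`-factors at the bottom and at the top. The
boundary factor of a left label `a` is likewise the polynomial `α₀^a ∏_{i<a} (κ_r - e(r) q^i) /
(q;q)_a`. Hence the function is a constant times `multiRow`, a composition of row transfer kernels
polynomial in `κ` (`spinWhittaker_eq_multiRow`).

Symmetry then reduces to interchanging the variables of two adjacent rows (`rowKernel_comm`). For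
fixed left labels, the interchange amounts to moving part of the lower left label to the upper row,
with weight `hRatio q y x d` for the amount `d` (`twoRowSum_exchange`). This relation passes from
column to column, because the `e`-parameters depend only on `r + c`. For a single column it is
Sears' transformation of a terminating balanced `₄φ₃` (`pairWeight_exchange`, `sears`). Summing over
the left labels absorbs the moved amount by the `q`-Vandermonde sum (`sum_hPoch_mul_hPoch`).

Sears' transformation is derived from two terminating sums, `sum_gauss_mul_saalTerm` and
`sum_gauss_mul_fallTerm`, each proved by an explicit telescoping certificate. -/

/-- The homogeneous `q`-Pochhammer symbol `∏_{i < n} (x - y q^i)`. -/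
noncomputable def hPoch (q x y : ℂ) (n : ℕ) : ℂ := ∏ i ∈ Finset.range n, (x - y * q ^ i)

/-- The falling `q`-factorial `∏_{i < j} (1 - q^{n-i})`, which vanishes for `j > n`. -/
noncomputable def qFall (q : ℂ) (n j : ℕ) : ℂ := ∏ i ∈ Finset.range j, (1 - q ^ (n - i))

/-- The Gaussian binomial coefficient. -/
noncomputable def gauss (q : ℂ) (n j : ℕ) : ℂ := qFall q n j / qPoch q q j

/-! ### `q`-Pochhammer symbols and Gaussian binomials. -/

section qSeries

variable {q : ℂ}

@[simp] theorem qPoch_zero (x : ℂ) : qPoch x q 0 = 1 := by simp [qPoch]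

@[simp] theorem hPoch_zero (x y : ℂ) : hPoch q x y 0 = 1 := by simp [hPoch]

@[simp] theorem qFall_zero (n : ℕ) : qFall q n 0 = 1 := by simp [qFall]

@[simp] theorem gauss_zero (n : ℕ) : gauss q n 0 = 1 := by simp [gauss]

theorem qPoch_succ (x : ℂ) (n : ℕ) : qPoch x q (n + 1) = qPoch x q n * (1 - x * q ^ n) :=
  Finset.prod_range_succ _ _

theorem hPoch_succ (x y : ℂ) (n : ℕ) : hPoch q x y (n + 1) = hPoch q x y n * (x - y * q ^ n) :=
  Finset.prod_range_succ _ _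

theorem qFall_succ (n j : ℕ) : qFall q n (j + 1) = qFall q n j * (1 - q ^ (n - j)) :=
  Finset.prod_range_succ _ _

theorem qPoch_add (x : ℂ) (m n : ℕ) :
    qPoch x q (m + n) = qPoch x q m * qPoch (x * q ^ m) q n := by
  simp only [qPoch, Finset.prod_range_add, pow_add, mul_assoc]

theorem hPoch_add (x y : ℂ) (m n : ℕ) :
    hPoch q x y (m + n) = hPoch q x y m * hPoch q x (y * q ^ m) n := by
  simp only [hPoch, Finset.prod_range_add, pow_add, mul_assoc]

theorem qPoch_succ' (x : ℂ) (n : ℕ) :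
    qPoch x q (n + 1) = (1 - x) * qPoch (x * q) q n := by
  rw [add_comm, qPoch_add]; simp [qPoch]

theorem hPoch_mul_right (c x y : ℂ) (n : ℕ) :
    hPoch q (c * x) (c * y) n = c ^ n * hPoch q x y n := by
  rw [hPoch, hPoch, Finset.prod_congr rfl fun i _ =>
    show c * x - c * y * q ^ i = c * (x - y * q ^ i) by ring, Finset.prod_mul_distrib,
    Finset.prod_const, Finset.card_range]

theorem qPoch_eq_hPoch (x : ℂ) (n : ℕ) : qPoch x q n = hPoch q 1 x n := rfl

theorem pow_mul_qPoch_div {x : ℂ} (hx : x ≠ 0) (y : ℂ) (n : ℕ) :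
    x ^ n * qPoch (y / x) q n = hPoch q x y n := by
  rw [qPoch_eq_hPoch, ← hPoch_mul_right, mul_one, mul_div_cancel₀ _ hx]

theorem qFall_succ_succ (n j : ℕ) :
    qFall q (n + 1) (j + 1) = (1 - q ^ (n + 1)) * qFall q n j := by
  simp only [qFall, Finset.prod_range_succ', Nat.add_sub_add_right, Nat.sub_zero]
  ring

theorem qFall_eq_zero {n j : ℕ} (h : n < j) : qFall q n j = 0 :=
  Finset.prod_eq_zero (Finset.mem_range.2 h) (by simp)

theorem gauss_eq_zero {n j : ℕ} (h : n < j) : gauss q n j = 0 := by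
  simp [gauss, qFall_eq_zero h]

theorem qPoch_self_add (n j : ℕ) :
    qPoch q q (n + j) = qFall q (n + j) j * qPoch q q n := by
  induction j with
  | zero => simp
  | succ j ih =>
    rw [← add_assoc, qPoch_succ, ih, qFall_succ_succ]
    ring

theorem qFall_self (n : ℕ) : qFall q n n = qPoch q q n := by
  simpa using (qPoch_self_add (q := q) 0 n).symm

theorem qPoch_self_ne_zero (hq : ∀ m : ℕ, 1 ≤ m → q ^ m ≠ 1) (n : ℕ) : qPoch q q n ≠ 0 := by
  refine Finset.prod_ne_zero_iff.2 fun i _ h => hq (i + 1) (by omega) ?_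
  rw [pow_succ']
  linear_combination -h

theorem one_sub_pow_ne_zero (hq : ∀ m : ℕ, 1 ≤ m → q ^ m ≠ 1) (n : ℕ) :
    1 - q ^ (n + 1) ≠ 0 := fun h => hq (n + 1) (by omega) (by linear_combination -h)

theorem gauss_self (hq : ∀ m : ℕ, 1 ≤ m → q ^ m ≠ 1) (n : ℕ) : gauss q n n = 1 := by
  rw [gauss, qFall_self, div_self (qPoch_self_ne_zero hq n)]

theorem qPoch_self_succ (n : ℕ) : qPoch q q (n + 1) = qPoch q q n * (1 - q ^ (n + 1)) := by
  rw [qPoch_succ, pow_succ']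

theorem gauss_succ_mul (hq : ∀ m : ℕ, 1 ≤ m → q ^ m ≠ 1) (n j : ℕ) :
    gauss q n (j + 1) * (1 - q ^ (j + 1)) = gauss q n j * (1 - q ^ (n - j)) := by
  have h1 := qPoch_self_ne_zero hq j
  have h2 := one_sub_pow_ne_zero hq j
  rw [gauss, gauss, qFall_succ, qPoch_self_succ]
  field_simp

theorem gauss_succ_succ (hq : ∀ m : ℕ, 1 ≤ m → q ^ m ≠ 1) (n j : ℕ) :
    gauss q (n + 1) (j + 1) = q ^ (j + 1) * gauss q n (j + 1) + gauss q n j := by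
  rcases lt_or_ge n j with h | h
  · simp [gauss_eq_zero h, gauss_eq_zero (Nat.lt_succ_of_lt h),
      gauss_eq_zero (Nat.succ_lt_succ h)]
  · obtain ⟨r, rfl⟩ := Nat.exists_eq_add_of_le h
    have h1 := qPoch_self_ne_zero hq j
    have h2 := one_sub_pow_ne_zero hq j
    rw [gauss, gauss, gauss, qFall_succ_succ, qFall_succ, qPoch_self_succ,
      Nat.add_sub_cancel_left]
    field_simp
    ring

/-! ### Two terminating sums by creative telescoping. -/

/-- The terms of the polynomial form of the `q`-Pfaff–Saalschütz sum. -/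
noncomputable def saalTerm (q X y b A : ℂ) (n i : ℕ) : ℂ :=
  hPoch q X b (n - i) * hPoch q y X i * qPoch (A * y) q (n - i) * qPoch (b * A * q ^ (n - i)) q i

/-- The factor `(1 - A X q^n) (y - b q^n)` is the ratio of the closed forms at `n + 1` and `n`. The
right side is the telescoping certificate, so induction on `j` needs only the Pascal rule and the
ratio of neighbouring Gaussian binomials. -/
theorem saalTerm_telescope (hq : ∀ m : ℕ, 1 ≤ m → q ^ m ≠ 1) (X y b A : ℂ) (n j : ℕ)
    (hj : j ≤ n) :
    ∑ i ∈ Finset.range (j + 1), (gauss q (n + 1) i * saalTerm q X y b A (n + 1) i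
        - (1 - A * X * q ^ n) * (y - b * q ^ n) * (gauss q n i * saalTerm q X y b A n i)) =
      -(gauss q n j * hPoch q X b (n - j) * hPoch q y X (j + 1) * qPoch (A * y) q (n - j)
        * qPoch (b * A * q ^ (n - j)) q j * (1 - b * A * q ^ (n + (n - j)))) := by
  induction j with
  | zero =>
    simp only [zero_add, Finset.range_one, Finset.sum_singleton, gauss_zero, saalTerm,
      Nat.sub_zero, hPoch_succ, qPoch_succ, hPoch_zero, qPoch_zero, pow_add, pow_zero]
    ring
  | succ j ih =>
    rw [Finset.sum_range_succ, ih (by omega)]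
    obtain ⟨r, rfl⟩ := Nat.exists_eq_add_of_le hj
    have e1 : j + 1 + r - j = r + 1 := by omega
    have e2 : j + 1 + r + 1 - (j + 1) = r + 1 := by omega
    have e3 : j + 1 + r - (j + 1) = r := by omega
    have hg := gauss_succ_mul hq (j + 1 + r) j
    rw [e1] at hg
    simp only [saalTerm, e1, e2, e3, gauss_succ_succ hq, hPoch_succ X b r,
      hPoch_succ y X (j + 1), qPoch_succ (A * y) r]
    rw [qPoch_succ _ j, qPoch_succ' (b * A * q ^ r) j, mul_assoc (b * A) (q ^ r) q, ← pow_succ]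
    linear_combination (hPoch q X b r * hPoch q y X (j + 1) * qPoch (A * y) q r *
      qPoch (b * A * q ^ (r + 1)) q j * (X - b * q ^ r) * (1 - A * y * q ^ r) * (b * A)
        * q ^ (j + 1 + r)) * hg

/-- The polynomial form of the `q`-Pfaff–Saalschütz sum. -/
theorem sum_gauss_mul_saalTerm (hq : ∀ m : ℕ, 1 ≤ m → q ^ m ≠ 1) (X y b A : ℂ) (n : ℕ) :
    ∑ i ∈ Finset.range (n + 1), gauss q n i * saalTerm q X y b A n i =
      qPoch (A * X) q n * hPoch q y b n := by
  induction n with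
  | zero => simp [saalTerm]
  | succ n ih =>
    have h := saalTerm_telescope hq X y b A n n le_rfl
    -- At `j = n` the certificate is minus the one missing term `i = n + 1` of the longer sum, so
    -- the two cancel.
    rw [Finset.sum_sub_distrib, ← Finset.mul_sum, ih] at h
    rw [Finset.sum_range_succ, qPoch_succ, hPoch_succ, sub_eq_iff_eq_add.1 h, gauss_self hq,
      gauss_self hq, saalTerm]
    simp only [Nat.sub_self, pow_zero, mul_one, hPoch_zero, qPoch_zero, qPoch_succ (b * A) n,
      add_zero]
    ring

/-- The terms of the expansion of a product of two falling `q`-factorials. -/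
noncomputable def fallTerm (q : ℂ) (b e dl n j : ℕ) : ℂ :=
  q ^ (j * (dl - (n - j))) * qFall q dl (n - j) * qFall q b j * qFall q e j
    * qFall q (b + e + dl - j) (n - j)

/-- One step of the telescoping below, with `n = i + r`. The number `g'` stands for the Gaussian
binomial of `i + r` over `i - 1`, read as `0` when `i = 0`, so that the start and the inductive step
share one computation. -/
theorem fallTerm_step (b e dl i r : ℕ) (g' : ℂ)
    (hg : gauss q (i + r + 1) i = q ^ i * gauss q (i + r) i + g')
    (hg' : gauss q (i + r) i * (1 - q ^ i) = g' * (1 - q ^ (r + 1))) :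
    gauss q (i + r + 1) i * fallTerm q b e dl (i + r + 1) i
      - (1 - q ^ (b + dl - (i + r))) * (1 - q ^ (e + dl - (i + r)))
        * (gauss q (i + r) i * fallTerm q b e dl (i + r) i)
      - g' * q ^ (i * (dl - (r + 1))) * qFall q dl (r + 1) * qFall q b i * qFall q e i
        * qFall q (b + e + dl - i) r * (1 - q ^ (b + e + dl - i + 1)) =
    -(gauss q (i + r) i * q ^ ((i + 1) * (dl - r)) * qFall q dl r * qFall q b (i + 1)
        * qFall q e (i + 1) * qFall q (b + e + dl - i) r) := by
  have e1 : i + r + 1 - i = r + 1 := by omega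
  have e2 : i + r - i = r := by omega
  simp only [fallTerm, e1, e2, qFall_succ]
  rcases lt_or_ge dl r with h | h
  · simp [qFall_eq_zero h]
  rcases lt_or_ge b i with h2 | h2
  · simp [qFall_eq_zero h2]
  rcases lt_or_ge e i with h3 | h3
  · simp [qFall_eq_zero h3]
  obtain ⟨d, rfl⟩ := Nat.exists_eq_add_of_le h
  obtain ⟨b, rfl⟩ := Nat.exists_eq_add_of_le h2
  obtain ⟨e, rfl⟩ := Nat.exists_eq_add_of_le h3
  have e3 : i + b + (r + d) - (i + r) = b + d := by omega
  have e4 : i + e + (r + d) - (i + r) = e + d := by omega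
  have e5 : i + b + (i + e) + (r + d) - i - r = i + b + e + d := by omega
  have e6 : i + b + (i + e) + (r + d) - i + 1 = i + b + e + r + d + 1 := by omega
  simp only [e3, e4, e5, e6, Nat.add_sub_cancel_left]
  -- For `d = 0` the exponent `dl - (r + 1)` truncates, which is harmless because the falling
  -- factorial beside it vanishes.
  cases d with
  | zero => simp only [pow_zero, add_zero, Nat.mul_zero]; ring
  | succ d =>
    have e7 : r + (d + 1) - (r + 1) = d := by omega
    have e8 : i * (d + 1) = i * d + i := by ring
    have e9 : (i + 1) * (d + 1) = i * d + i + d + 1 := by ring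
    rw [hg, e7, e8, e9]
    have e10 : i + b + (i + e) + (r + (d + 1)) - i + 1 = i + b + e + r + d + 2 := by omega
    rw [← sub_eq_zero]
    linear_combination (q ^ (i * d) * qFall q (r + (d + 1)) r * qFall q (i + b) i
      * qFall q (i + e) i * qFall q (i + b + (i + e) + (r + (d + 1)) - i) r
      * (1 - q ^ (d + 1)) * q ^ (d + 1 + b + e + i)) * hg'

theorem fallTerm_telescope (hq : ∀ m : ℕ, 1 ≤ m → q ^ m ≠ 1) (b e dl n j : ℕ) (hj : j ≤ n) :
    ∑ i ∈ Finset.range (j + 1), (gauss q (n + 1) i * fallTerm q b e dl (n + 1) i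
        - (1 - q ^ (b + dl - n)) * (1 - q ^ (e + dl - n))
          * (gauss q n i * fallTerm q b e dl n i)) =
      -(gauss q n j * q ^ ((j + 1) * (dl - (n - j))) * qFall q dl (n - j) * qFall q b (j + 1)
        * qFall q e (j + 1) * qFall q (b + e + dl - j) (n - j)) := by
  induction j with
  | zero =>
    have := fallTerm_step (q := q) b e dl 0 n 0 (by simp) (by simp)
    simpa using this
  | succ j ih =>
    rw [Finset.sum_range_succ, ih (by omega)]
    obtain ⟨r, rfl⟩ := Nat.exists_eq_add_of_le hj
    have e1 : j + 1 + r - j = r + 1 := by omega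
    have hg := gauss_succ_mul hq (j + 1 + r) j
    rw [e1] at hg
    have := fallTerm_step b e dl (j + 1) r _ (gauss_succ_succ hq _ _) hg
    rw [e1, Nat.add_sub_cancel_left, ← this]
    rcases lt_or_ge b (j + 1) with h2 | h2
    · simp [qFall_eq_zero h2]
    have e2 : b + e + dl - j = b + e + dl - (j + 1) + 1 := by omega
    rw [e2, qFall_succ_succ]
    ring

/-- This re-expands a product of falling factorials with tops raised by `dl` in those with tops `b`
and `e`, which is what compares two Sears sums of different sizes. -/
theorem sum_gauss_mul_fallTerm (hq : ∀ m : ℕ, 1 ≤ m → q ^ m ≠ 1) (b e dl n : ℕ) :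
    ∑ i ∈ Finset.range (n + 1), gauss q n i * fallTerm q b e dl n i =
      qFall q (b + dl) n * qFall q (e + dl) n := by
  induction n with
  | zero => simp [fallTerm]
  | succ n ih =>
    have h := fallTerm_telescope hq b e dl n n le_rfl
    rw [Finset.sum_sub_distrib, ← Finset.mul_sum, ih] at h
    rw [Finset.sum_range_succ, qFall_succ, qFall_succ, sub_eq_iff_eq_add.1 h, gauss_self hq,
      gauss_self hq, fallTerm]
    simp only [Nat.sub_self, Nat.sub_zero, qFall_zero]
    ring

/-! ### Sears' transformation. -/

/-- The terms of the balanced `₄φ₃` sum. -/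
noncomputable def searsTerm (q x y β α : ℂ) (N b e d : ℕ) : ℂ :=
  hPoch q x β (b - d) * hPoch q y x d * qPoch (α * y) q (e - d) * qFall q b d * qFall q e d
    * qPoch q q (N - d) / (qPoch q q d * qPoch (β * α) q (N - d))

/-- The terminating balanced `₄φ₃` sum. -/
noncomputable def searsSum (q x y β α : ℂ) (N b e : ℕ) : ℂ :=
  ∑ d ∈ Finset.range (N + 1), searsTerm q x y β α N b e d

/-- After `sum_gauss_mul_fallTerm` is inserted, each summand splits into a term of the smaller Sears
sum and a term of a Saalschütz sum of length `dl`, whose parameters are shifted by powers of `q`. -/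
theorem searsTerm_expand (hq : ∀ m : ℕ, 1 ≤ m → q ^ m ≠ 1) (x y β α : ℂ)
    (hβα : ∀ m, qPoch (β * α) q m ≠ 0) (b e dl k : ℕ) (hk : k ≤ b + e + dl) :
    searsTerm q x y β α (b + e + dl) (b + dl) (e + dl) k =
      ∑ j ∈ Finset.range (k + 1), searsTerm q x y β α (b + e + dl) b e j
        * (gauss q dl (k - j) * saalTerm q (x * q ^ j) y (β * q ^ b) (α * q ^ (e - j)) dl
          (k - j)) := by
  have h := sum_gauss_mul_fallTerm hq b e dl k
  rw [searsTerm, mul_assoc _ (qFall q (b + dl) k), ← h, Finset.mul_sum, Finset.sum_mul,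
    Finset.sum_div]
  refine Finset.sum_congr rfl fun j hj => ?_
  obtain ⟨i, rfl⟩ := Nat.exists_eq_add_of_le (Nat.lt_succ_iff.1 (Finset.mem_range.1 hj))
  rw [Nat.add_sub_cancel_left, searsTerm, saalTerm, fallTerm, Nat.add_sub_cancel_left]
  rcases lt_or_ge dl i with h1 | h1
  · simp [qFall_eq_zero h1, gauss_eq_zero h1]
  rcases lt_or_ge b j with h2 | h2
  · simp [qFall_eq_zero h2]
  rcases lt_or_ge e j with h3 | h3
  · simp [qFall_eq_zero h3]
  obtain ⟨d, rfl⟩ := Nat.exists_eq_add_of_le h1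
  obtain ⟨b, rfl⟩ := Nat.exists_eq_add_of_le h2
  obtain ⟨e, rfl⟩ := Nat.exists_eq_add_of_le h3
  have e1 : j + b + (i + d) - (j + i) = b + d := by omega
  have e2 : j + e + (i + d) - (j + i) = e + d := by omega
  have e3 : j + b + (j + e) + (i + d) - (j + i) = b + e + j + d := by omega
  have e4 : j + b + (j + e) + (i + d) - j = b + e + j + d + i := by omega
  simp only [e1, e2, e3, e4, Nat.add_sub_cancel_left]
  have e5 : β * q ^ (j + b) * (α * q ^ e) * q ^ d = β * α * q ^ (b + e + j + d) := by ring
  have e6 : α * q ^ e * y = α * y * q ^ e := by ring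
  have e7 : β * q ^ (j + b) = q ^ j * (β * q ^ b) := by ring
  have n3 := qPoch_self_ne_zero hq (j + i)
  have n5 : qPoch (β * α * q ^ (b + e + j + d)) q i ≠ 0 := by
    have := hβα (b + e + j + d + i)
    rw [qPoch_add] at this
    exact right_ne_zero_of_mul this
  have n6 := qPoch_self_add (q := q) i j
  have n7 := qPoch_self_add (q := q) (b + e + j + d) i
  rw [e5, e6, e7, mul_comm x, hPoch_mul_right, hPoch_add, hPoch_add, qPoch_add (α * y),
    qPoch_add (β * α) (b + e + j + d) i, n7, gauss, gauss, add_comm j i, n6, mul_comm x, ← pow_mul]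
  rw [add_comm j i, n6] at n3
  have n8 := left_ne_zero_of_mul n3
  have h5 := mul_inv_cancel₀ n8
  have h6 := mul_inv_cancel₀ n5
  simp only [div_eq_mul_inv, mul_inv]
  linear_combination (hPoch q x β b * hPoch q x (β * q ^ b) d * hPoch q y x j
    * hPoch q y (q ^ j * x) i * qPoch (α * y) q e * qPoch (α * y * q ^ e) q d
    * qFall q (j + b) j * qFall q (j + e) j * q ^ (j * d) * qFall q (i + d) i
    * qFall q (b + e + j + d + i) i * qPoch q q (b + e + j + d) * (qPoch q q j)⁻¹
    * (qPoch q q i)⁻¹ * (qPoch (β * α) q (b + e + j + d))⁻¹) * (h5 - h6)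

/-- Interchange the two summations: for fixed `j` the inner sum is Saalschütz. Its value contains
`j` only through `α q^(e-j) * x q^j = α x q^e`, so it is independent of `j` and factors out. -/
theorem searsSum_add (hq : ∀ m : ℕ, 1 ≤ m → q ^ m ≠ 1) (x y β α : ℂ)
    (hβα : ∀ m, qPoch (β * α) q m ≠ 0) (b e dl : ℕ) :
    searsSum q x y β α (b + e + dl) (b + dl) (e + dl) =
      qPoch (α * x * q ^ e) q dl * hPoch q y (β * q ^ b) dl
        * searsSum q x y β α (b + e + dl) b e := by
  rw [searsSum, Finset.sum_congr rfl fun k hk => searsTerm_expand hq x y β α hβα b e dl k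
    (Nat.lt_succ_iff.1 (Finset.mem_range.1 hk))]
  have := Finset.sum_range_diag_flip (b + e + dl + 1) fun j i =>
    searsTerm q x y β α (b + e + dl) b e j
        * (gauss q dl i * saalTerm q (x * q ^ j) y (β * q ^ b) (α * q ^ (e - j)) dl i)
  rw [this, searsSum, Finset.mul_sum]
  refine Finset.sum_congr rfl fun j hj => ?_
  rw [← Finset.mul_sum, mul_comm]
  rcases lt_or_ge b j with h2 | h2
  · simp [searsTerm, qFall_eq_zero h2]
  rcases lt_or_ge e j with h3 | h3
  · simp [searsTerm, qFall_eq_zero h3]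
  congr 1
  rw [← Finset.sum_subset (Finset.range_mono (show dl + 1 ≤ b + e + dl + 1 - j by omega))
    fun i _ hi => by
      rw [gauss_eq_zero (by simpa using hi), zero_mul], sum_gauss_mul_saalTerm hq]
  congr 2
  rw [mul_mul_mul_comm, ← pow_add, Nat.sub_add_cancel h3]

/-- Sears' transformation of a terminating balanced `₄φ₃`, in a division-free form. -/
theorem sears (hq : ∀ m : ℕ, 1 ≤ m → q ^ m ≠ 1) (x y β α : ℂ)
    (hβα : ∀ m, qPoch (β * α) q m ≠ 0) (N b p e c : ℕ) (h1 : b + p = N) (h2 : e + c = N) :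
    qPoch (α * x) q p * hPoch q y β c * searsSum q x y β α N b e =
      qPoch (α * x) q e * hPoch q y β b * searsSum q x y β α N c p := by
  -- Exchanging `b` with `c` and `p` with `e` swaps the two sides. When `b ≤ c`, the sum on the
  -- right is the one on the left enlarged by `dl = c - b = p - e`.
  wlog h : b ≤ c generalizing b p e c
  · exact (this c e p b (by omega) (by omega) (by omega)).symm
  obtain ⟨dl, rfl⟩ := Nat.exists_eq_add_of_le h
  obtain rfl : p = e + dl := by omega
  obtain rfl : N = b + e + dl := by omega
  rw [searsSum_add hq x y β α hβα, qPoch_add, hPoch_add]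
  ring

/-- The case `A = 0` of the Saalschütz sum, a form of `q`-Vandermonde. -/
theorem sum_hPoch_mul_hPoch (hq : ∀ m : ℕ, 1 ≤ m → q ^ m ≠ 1) (x y β : ℂ) (n : ℕ) :
    ∑ p ∈ Finset.HasAntidiagonal.antidiagonal n, hPoch q x β p.1 / qPoch q q p.1
        * (hPoch q y x p.2 / qPoch q q p.2) =
      hPoch q y β n / qPoch q q n := by
  have h := sum_gauss_mul_saalTerm hq x y β 0 n
  simp only [zero_mul, mul_zero, saalTerm] at h
  have h0 : ∀ m, qPoch 0 q m = 1 := fun m => by simp [qPoch]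
  simp only [h0, mul_one, one_mul] at h
  rw [← h, ← Finset.Nat.sum_antidiagonal_swap, Finset.Nat.sum_antidiagonal_eq_sum_range_succ_mk,
    Finset.sum_div]
  refine Finset.sum_congr rfl fun i hi => ?_
  obtain ⟨r, rfl⟩ := Nat.exists_eq_add_of_le (Nat.lt_succ_iff.1 (Finset.mem_range.1 hi))
  have n1 := qPoch_self_ne_zero hq i
  have n2 := qPoch_self_ne_zero hq r
  have n3 := qPoch_self_ne_zero hq (i + r)
  have n4 := qPoch_self_add (q := q) r i
  rw [add_comm r i] at n4
  rw [n4] at n3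
  have n5 := left_ne_zero_of_mul n3
  simp only [Prod.fst_swap, Prod.snd_swap, Nat.add_sub_cancel_left, gauss, n4]
  field_simp

end qSeries
-- Transfer matrices as sums over paths.
section PathSum

variable {ι : Type*}

/-- The sum over all paths of `L` steps in `S` that start at `x`, of the product of the weights
`w c` of the steps and the weight `g` of the end point. -/
noncomputable def pathSum (S : Finset ι) :
    (L : ℕ) → (Fin L → ι → ι → ℂ) → (ι → ℂ) → ι → ℂ
  | 0, _, g, x => g x
  | L + 1, w, g, x => ∑ y ∈ S, w 0 x y * pathSum S L (fun c => w c.succ) g y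

theorem sum_piFinset_succ {L : ℕ} (S : Finset ι) (f : (Fin (L + 1) → ι) → ℂ) :
    ∑ m ∈ Fintype.piFinset (fun _ : Fin (L + 1) => S), f m =
      ∑ y ∈ S, ∑ m ∈ Fintype.piFinset (fun _ : Fin L => S), f (Fin.cons y m) := by
  rw [← Finset.sum_product']
  refine Finset.sum_bij' (fun m _ => (m 0, Fin.tail m)) (fun p _ => Fin.cons p.1 p.2)
    ?_ ?_ ?_ ?_ ?_
  · intro m hm
    rw [Fintype.mem_piFinset] at hm
    simp only [Finset.mem_product, Fintype.mem_piFinset]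
    exact ⟨hm 0, fun c => hm c.succ⟩
  · rintro ⟨y, m⟩ hp
    simp only [Finset.mem_product, Fintype.mem_piFinset] at hp ⊢
    intro c
    induction c using Fin.cases with
    | zero => exact hp.1
    | succ c => exact hp.2 c
  · intro m _
    exact Fin.cons_self_tail m
  · rintro ⟨y, m⟩ _
    simp
  · intro m _
    rw [Fin.cons_self_tail]

theorem sum_piFinset_zero (S : Finset ι) (f : (Fin 0 → ι) → ℂ) (m : Fin 0 → ι) :
    ∑ m ∈ Fintype.piFinset (fun _ : Fin 0 => S), f m = f m := by
  rw [Finset.sum_eq_single m]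
  · intro b _ hb
    exact absurd (Subsingleton.elim b m) hb
  · intro h
    exact absurd (Fintype.mem_piFinset.2 fun c => c.elim0) h

theorem sum_piFinset_eq_pathSum (S : Finset ι) (L : ℕ) (w : Fin L → ι → ι → ℂ)
    (f g : ι → ℂ) :
    ∑ h ∈ Fintype.piFinset (fun _ : Fin (L + 1) => S),
        f (h 0) * (∏ c : Fin L, w c (h c.castSucc) (h c.succ)) * g (h (Fin.last L)) =
      ∑ x ∈ S, f x * pathSum S L w g x := by
  induction L generalizing f with
  | zero =>
    rw [sum_piFinset_succ]
    refine Finset.sum_congr rfl fun x _ => ?_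
    rw [sum_piFinset_zero _ _ Fin.elim0]
    simp [pathSum]
  | succ L ih =>
    rw [sum_piFinset_succ]
    refine Finset.sum_congr rfl fun x _ => ?_
    rw [pathSum, ← ih, Finset.mul_sum]
    refine Finset.sum_congr rfl fun h _ => ?_
    simp only [Fin.prod_univ_succ, Fin.cons_zero, Fin.castSucc_zero, Fin.cons_succ,
      ← Fin.succ_castSucc, ← Fin.succ_last]
    ring

end PathSum

/-! ### Exchange relation for two adjacent rows. -/

section TwoRows

variable {q : ℂ}

/-- The ratio `∏_{i < n} (x - y q^i) / (q; q)_n`. -/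
noncomputable def hRatio (q x y : ℂ) (n : ℕ) : ℂ := hPoch q x y n / qPoch q q n

/-- The vertex weight in the gauge in which it is polynomial in `κ`; the labels `m`, `k`, `h`,
`h'` are those of the bottom, top, left and right edge. -/
noncomputable def rowWeight (q κ α A β : ℂ) (m k h h' : ℕ) : ℂ :=
  if m + h = k + h' ∧ h' ≤ m then
    α ^ h' * hRatio q κ β h' * (qPoch (α * κ) q (m - h') / qPoch q q (m - h'))
      * (qPoch q q k / qPoch (A * α) q k)
  else 0

/-- The partition function of a row with left label `h` and right label `0`. -/
noncomputable def rowSum (q κ : ℂ) (al e : ℕ → ℂ) (M L : ℕ) (k m : Fin L → ℕ) (h : ℕ) : ℂ :=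
  pathSum (Finset.range (M + 1)) L
    (fun c => rowWeight q κ (al c) (e c) (e (c + 1)) (m c) (k c))
    (fun h => if h = 0 then 1 else 0) h

/-- The partition function of two rows with left labels `b` and `c` and right labels `0`. -/
noncomputable def twoRowSum (q x y : ℂ) (al e : ℕ → ℂ) (M L : ℕ) (k i : Fin L → ℕ)
    (b c : ℕ) : ℂ :=
  ∑ m ∈ Fintype.piFinset (fun _ : Fin L => Finset.range (M + 1)),
    rowSum q x al e M L k m b * rowSum q y al (fun j => e (j + 1)) M L m i c

theorem rowSum_succ (κ : ℂ) (al e : ℕ → ℂ) (M L : ℕ) (k m : Fin (L + 1) → ℕ) (h : ℕ) :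
    rowSum q κ al e M (L + 1) k m h = ∑ h' ∈ Finset.range (M + 1),
      rowWeight q κ (al 0) (e 0) (e 1) (m 0) (k 0) h h' *
        rowSum q κ (fun j => al (j + 1)) (fun j => e (j + 1)) M L (Fin.tail k) (Fin.tail m) h' := by
  simp only [rowSum, pathSum, Fin.val_succ, Fin.tail]
  rfl

theorem rowSum_conservation (κ : ℂ) (al e : ℕ → ℂ) (M L : ℕ) (k m : Fin L → ℕ) (h : ℕ)
    (hne : rowSum q κ al e M L k m h ≠ 0) : h + ∑ c, m c = ∑ c, k c := by
  induction L generalizing al e h with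
  | zero =>
    by_contra h0
    exact hne (by simp at h0; simp [rowSum, pathSum, h0])
  | succ L ih =>
    rw [rowSum_succ] at hne
    obtain ⟨h', -, hh⟩ := Finset.exists_ne_zero_of_sum_ne_zero hne
    have h1 := ih _ _ _ _ _ (right_ne_zero_of_mul hh)
    have h2 := left_ne_zero_of_mul hh
    rw [rowWeight] at h2
    have h3 := (ite_ne_right_iff.1 h2).1.1
    simp only [Fin.tail] at h1
    rw [Fin.sum_univ_succ, Fin.sum_univ_succ]
    omega

theorem twoRowSum_conservation (x y : ℂ) (al e : ℕ → ℂ) (M L : ℕ) (k i : Fin L → ℕ) (b c : ℕ)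
    (hne : twoRowSum q x y al e M L k i b c ≠ 0) : b + c + ∑ j, i j = ∑ j, k j := by
  obtain ⟨m, -, hm⟩ := Finset.exists_ne_zero_of_sum_ne_zero hne
  have h1 := rowSum_conservation _ _ _ _ _ _ _ _ (left_ne_zero_of_mul hm)
  have h2 := rowSum_conservation _ _ _ _ _ _ _ _ (right_ne_zero_of_mul hm)
  omega

theorem twoRowSum_succ (x y : ℂ) (al e : ℕ → ℂ) (M L : ℕ) (k i : Fin (L + 1) → ℕ) (b c : ℕ) :
    twoRowSum q x y al e M (L + 1) k i b c =
      ∑ b' ∈ Finset.range (M + 1), ∑ c' ∈ Finset.range (M + 1),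
        (∑ m ∈ Finset.range (M + 1), rowWeight q x (al 0) (e 0) (e 1) m (k 0) b b' *
          rowWeight q y (al 0) (e 1) (e 2) (i 0) m c c') *
        twoRowSum q x y (fun j => al (j + 1)) (fun j => e (j + 1)) M L (Fin.tail k) (Fin.tail i)
          b' c' := by
  rw [twoRowSum, sum_piFinset_succ]
  simp only [twoRowSum, rowSum_succ, Fin.cons_zero, Fin.tail_cons, Finset.sum_mul_sum]
  rw [Finset.sum_congr rfl fun m _ => Finset.sum_comm, Finset.sum_comm]
  refine Finset.sum_congr rfl fun b' _ => ?_
  rw [Finset.sum_congr rfl fun m _ => Finset.sum_comm, Finset.sum_comm]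
  exact Finset.sum_congr rfl fun _ _ => Finset.sum_congr rfl fun _ _ =>
    Finset.sum_congr rfl fun _ _ => mul_mul_mul_comm _ _ _ _

/-- The combined weight of the two vertices of a column in two adjacent rows, without the factor
that depends on the spin parameter of the lower right edge. -/
noncomputable def pairWeight (q x y α A β : ℂ) (c₀ k i b c : ℕ) : ℂ :=
  if c ≤ i ∧ b ≤ i + c₀ - c then
    α ^ (b + c) * hRatio q x β b
      * (qPoch (α * x) q (i + c₀ - c - b) / qPoch q q (i + c₀ - c - b))
      * (qPoch (α * y) q (i - c) / qPoch q q (i - c))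
      * (qPoch q q (i + c₀ - c) / qPoch (β * α) q (i + c₀ - c))
      * (qPoch q q k / qPoch (A * α) q k)
  else 0

/-- Conservation leaves a single possible label `i + c₀ - c` on the middle edge. The factor with `γ`
is split off because in the exchange argument it belongs to the columns further right. -/
theorem sum_rowWeight_mul_rowWeight (x y α A β γ : ℂ) (M b₀ c₀ k i b c : ℕ)
    (h : b₀ + c₀ + i = k + b + c) (hM : i + c₀ ≤ M) :
    ∑ m ∈ Finset.range (M + 1), rowWeight q x α A β m k b₀ b * rowWeight q y α β γ i m c₀ c =
      pairWeight q x y α A β c₀ k i b c * hRatio q y γ c := by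
  rw [Finset.sum_eq_single (i + c₀ - c)]
  · by_cases hc : c ≤ i
    · by_cases hb : b ≤ i + c₀ - c
      · rw [rowWeight, rowWeight, pairWeight, if_pos ⟨by omega, hb⟩, if_pos ⟨by omega, hc⟩,
          if_pos ⟨hc, hb⟩]
        ring
      · simp [rowWeight, pairWeight, hb]
    · simp [rowWeight, pairWeight, hc]
  · intro m _ hm
    rw [rowWeight, rowWeight, if_neg (c := i + c₀ = m + c ∧ c ≤ i) (by omega), mul_zero]
  · intro hm
    exact absurd (Finset.mem_range.2 (by omega)) hm

/-- Peeling off the first column: conservation in the remaining columns forces the outgoing labels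
to have total `s`. The bound `M` is large enough for the cutoffs to lose nothing. -/
theorem twoRowSum_succ_eq_sum_antidiagonal (x y : ℂ) (al e : ℕ → ℂ) (M L : ℕ)
    (k i : Fin (L + 1) → ℕ) (b₀ c₀ s : ℕ) (hs : b₀ + c₀ + i 0 = k 0 + s)
    (hk : ∑ j, k j ≤ M) (hb : b₀ + c₀ + ∑ j, i j = ∑ j, k j) :
    twoRowSum q x y al e M (L + 1) k i b₀ c₀ =
      ∑ p ∈ Finset.HasAntidiagonal.antidiagonal s,
        pairWeight q x y (al 0) (e 0) (e 1) c₀ (k 0) (i 0) p.1 p.2 * (hRatio q y (e 2) p.2 *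
        twoRowSum q x y (fun j => al (j + 1)) (fun j => e (j + 1)) M L (Fin.tail k) (Fin.tail i)
          p.1 p.2) := by
  rw [Fin.sum_univ_succ, Fin.sum_univ_succ] at hb
  rw [Fin.sum_univ_succ] at hk
  rw [twoRowSum_succ, ← Finset.sum_product']
  symm
  refine Finset.sum_subset_zero_on_sdiff ?_ ?_ ?_
  · rintro ⟨b, c⟩ hp
    rw [Finset.HasAntidiagonal.mem_antidiagonal] at hp
    simp only [Finset.mem_product, Finset.mem_range]
    simp only at hp
    omega
  · rintro ⟨b, c⟩ hp
    simp only [Finset.mem_sdiff, Finset.HasAntidiagonal.mem_antidiagonal] at hp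
    by_contra hne
    have := twoRowSum_conservation _ _ _ _ _ _ _ _ _ _ (right_ne_zero_of_mul hne)
    simp only [Fin.tail] at this
    omega
  · rintro ⟨b, c⟩ hp
    rw [Finset.HasAntidiagonal.mem_antidiagonal] at hp
    simp only at hp ⊢
    rw [sum_rowWeight_mul_rowWeight _ _ _ _ _ _ _ _ _ _ _ _ _ (by omega) (by omega), mul_assoc]

theorem twoRowSum_succ_eq_zero (x y : ℂ) (al e : ℕ → ℂ) (M L : ℕ)
    (k i : Fin (L + 1) → ℕ) (b c : ℕ) (h : b + c + i 0 < k 0) :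
    twoRowSum q x y al e M (L + 1) k i b c = 0 := by
  rw [twoRowSum_succ]
  refine Finset.sum_eq_zero fun b' _ => Finset.sum_eq_zero fun c' _ => ?_
  rw [Finset.sum_eq_zero, zero_mul]
  intro m _
  by_contra hne
  have h1 := left_ne_zero_of_mul hne
  have h2 := right_ne_zero_of_mul hne
  rw [rowWeight] at h1 h2
  have h3 := (ite_ne_right_iff.1 h1).1.1
  have h4 := (ite_ne_right_iff.1 h2).1.1
  omega

/-- This matches the `d`-dependent part of a column weight with a Sears summand; the tops `b` and
`e` enter through `(q;q)_{b-d}` and `(q;q)_{e-d}`. -/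
theorem searsTerm_eq (hq : ∀ m : ℕ, 1 ≤ m → q ^ m ≠ 1) (x y β α : ℂ) (N b e d : ℕ)
    (hb : d ≤ b) (he : d ≤ e) :
    hRatio q x β (b - d) * (qPoch (α * y) q (e - d) / qPoch q q (e - d))
        * (qPoch q q (N - d) / qPoch (β * α) q (N - d)) * hRatio q y x d =
      searsTerm q x y β α N b e d / (qPoch q q b * qPoch q q e) := by
  obtain ⟨b, rfl⟩ := Nat.exists_eq_add_of_le' hb
  obtain ⟨e, rfl⟩ := Nat.exists_eq_add_of_le' he
  have h1 := qPoch_self_ne_zero hq (b + d)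
  have h2 := qPoch_self_ne_zero hq (e + d)
  rw [qPoch_self_add] at h1 h2
  have h3 := mul_inv_cancel₀ (left_ne_zero_of_mul h1)
  have h4 := mul_inv_cancel₀ (left_ne_zero_of_mul h2)
  simp only [searsTerm, hRatio, qPoch_self_add, Nat.add_sub_cancel, div_eq_mul_inv, mul_inv]
  generalize qFall q (b + d) d = f₁ at *
  generalize qFall q (e + d) d = f₂ at *
  linear_combination (-hPoch q x β b * hPoch q y x d * qPoch (α * y) q e * qPoch q q (N - d)
    * (qPoch q q d)⁻¹ * (qPoch (β * α) q (N - d))⁻¹ * (qPoch q q b)⁻¹ * (qPoch q q e)⁻¹)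
    * (f₂ * f₂⁻¹ * h3 + h4)

theorem sum_searsTerm_range (x y β α : ℂ) (N b e : ℕ) (hb : b ≤ N) :
    ∑ d ∈ Finset.range (b + 1), searsTerm q x y β α N b e d = searsSum q x y β α N b e := by
  refine Finset.sum_subset (Finset.range_mono (by omega)) fun d _ hd => ?_
  rw [searsTerm, qFall_eq_zero (by simpa using hd)]
  simp

/-- Outside `c ≤ i` and `b ≤ i + c₀ - c` both sides vanish. Otherwise, with `i = c + e` and `N = e +
c₀ = b + p`, the left sum is a Sears sum with tops `(b, e)` and the right one has tops `(c₀, p)`, so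
`sears` applies. The factor with `A` is common to both sides. -/
theorem pairWeight_exchange (hq : ∀ m : ℕ, 1 ≤ m → q ^ m ≠ 1) (x y α A β : ℂ)
    (hβα : ∀ m, qPoch (β * α) q m ≠ 0) (c₀ k i b c : ℕ) :
    hRatio q y β c₀ * ∑ p ∈ Finset.HasAntidiagonal.antidiagonal b,
        pairWeight q x y α A β c₀ k i p.1 (c + p.2) * hRatio q y x p.2 =
      ∑ p ∈ Finset.HasAntidiagonal.antidiagonal c₀, hRatio q y x p.1 * hRatio q x β p.2
        * pairWeight q y x α A β p.2 k i b c := by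
  by_cases hc : c ≤ i
  swap
  · simp only [pairWeight, hc, false_and, if_false, mul_zero, Finset.sum_const_zero]
    rw [Finset.sum_eq_zero, mul_zero]
    intro p _
    rw [if_neg (by omega), zero_mul]
  obtain ⟨e, rfl⟩ := Nat.exists_eq_add_of_le hc
  by_cases hb : b ≤ e + c₀
  swap
  · rw [Finset.sum_eq_zero, Finset.sum_eq_zero, mul_zero]
    · intro p hp
      rw [Finset.HasAntidiagonal.mem_antidiagonal] at hp
      rw [pairWeight, if_neg (by omega), mul_zero]
    · intro p hp
      rw [Finset.HasAntidiagonal.mem_antidiagonal] at hp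
      rw [pairWeight, if_neg (by omega), zero_mul]
  obtain ⟨p, hp⟩ := Nat.exists_eq_add_of_le hb
  set K := α ^ (b + c) * (qPoch q q k / qPoch (A * α) q k)
  have h1 : ∑ r ∈ Finset.HasAntidiagonal.antidiagonal b,
        pairWeight q x y α A β c₀ k (c + e) r.1 (c + r.2) * hRatio q y x r.2 =
      K * (qPoch (α * x) q p / qPoch q q p) * (searsSum q x y β α (e + c₀) b e
        / (qPoch q q b * qPoch q q e)) := by
    rw [← sum_searsTerm_range _ _ _ _ _ _ _ hb, Finset.sum_div, Finset.mul_sum,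
      ← Finset.Nat.sum_antidiagonal_swap, Finset.Nat.sum_antidiagonal_eq_sum_range_succ_mk]
    refine Finset.sum_congr rfl fun d hd => ?_
    have hd := Nat.lt_succ_iff.1 (Finset.mem_range.1 hd)
    simp only [Prod.fst_swap, Prod.snd_swap]
    by_cases he : d ≤ e
    · rw [← searsTerm_eq hq _ _ _ _ _ _ _ _ hd he, pairWeight, if_pos (by omega)]
      have e1 : c + e + c₀ - (c + d) - (b - d) = p := by omega
      have e2 : c + e + c₀ - (c + d) = e + c₀ - d := by omega
      have e3 : c + e - (c + d) = e - d := by omega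
      have e4 : b - d + (c + d) = b + c := by omega
      rw [e1, e2, e3, e4]
      ring
    · rw [pairWeight, if_neg (by omega), searsTerm, qFall_eq_zero (n := e) (by omega)]
      simp
  have h2 : ∑ r ∈ Finset.HasAntidiagonal.antidiagonal c₀, hRatio q y x r.1 * hRatio q x β r.2
        * pairWeight q y x α A β r.2 k (c + e) b c =
      K * hRatio q y β b * (qPoch (α * x) q e / qPoch q q e) *
        (searsSum q x y β α (e + c₀) c₀ p / (qPoch q q c₀ * qPoch q q p)) := by
    rw [← sum_searsTerm_range _ _ _ _ _ _ _ (by omega), Finset.sum_div, Finset.mul_sum,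
      Finset.Nat.sum_antidiagonal_eq_sum_range_succ_mk]
    refine Finset.sum_congr rfl fun d hd => ?_
    have hd := Nat.lt_succ_iff.1 (Finset.mem_range.1 hd)
    by_cases he : d ≤ p
    · rw [← searsTerm_eq hq _ _ _ _ _ _ _ _ hd he, pairWeight, if_pos (by omega)]
      have e1 : c + e + (c₀ - d) - c - b = p - d := by omega
      have e2 : c + e + (c₀ - d) - c = e + c₀ - d := by omega
      have e3 : c + e - c = e := by omega
      rw [e1, e2, e3]
      ring
    · rw [pairWeight, if_neg (by omega), searsTerm, qFall_eq_zero (n := p) (by omega)]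
      simp
  rw [h1, h2, hRatio, hRatio]
  have h3 := sears hq x y β α hβα (e + c₀) b p e c₀ hp.symm rfl
  simp only [div_eq_mul_inv, mul_inv]
  linear_combination (K * (qPoch q q c₀)⁻¹ * (qPoch q q p)⁻¹ * (qPoch q q b)⁻¹
    * (qPoch q q e)⁻¹) * h3

theorem sum_antidiagonal_antidiagonal (f : ℕ → ℕ → ℕ → ℂ) (n : ℕ) :
    ∑ p ∈ Finset.HasAntidiagonal.antidiagonal n,
        ∑ r ∈ Finset.HasAntidiagonal.antidiagonal p.2, f p.1 r.1 r.2 =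
      ∑ p ∈ Finset.HasAntidiagonal.antidiagonal n,
        ∑ r ∈ Finset.HasAntidiagonal.antidiagonal p.1, f r.1 r.2 p.2 := by
  rw [Finset.sum_sigma', Finset.sum_sigma']
  refine Finset.sum_bij' (fun t _ => ⟨(t.1.1 + t.2.1, t.2.2), (t.1.1, t.2.1)⟩)
    (fun t _ => ⟨(t.2.1, t.2.2 + t.1.2), (t.2.2, t.1.2)⟩) ?_ ?_ ?_ ?_ ?_
  all_goals
    rintro ⟨⟨a, b⟩, c, d⟩ h
    simp only [Finset.mem_sigma, Finset.HasAntidiagonal.mem_antidiagonal] at h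
    obtain ⟨rfl, rfl⟩ := h
    simp [add_assoc]

/-- The exchange relation for two rows: interchanging the parameters `x` and `y` of the rows
amounts to moving a part of the left label of the lower row to the upper row. -/
theorem twoRowSum_exchange (hq : ∀ m : ℕ, 1 ≤ m → q ^ m ≠ 1) (x y : ℂ) (al e : ℕ → ℂ) (M L : ℕ)
    (hne : ∀ j < L, ∀ m, qPoch (e (j + 1) * al j) q m ≠ 0) (k i : Fin L → ℕ) (b c : ℕ)
    (hk : ∑ j, k j ≤ M) (hb : b + c + ∑ j, i j = ∑ j, k j) :
    hRatio q y (e 1) c * twoRowSum q x y al e M L k i b c =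
      ∑ p ∈ Finset.HasAntidiagonal.antidiagonal c, hRatio q y x p.1 * (hRatio q x (e 1) p.2 *
        twoRowSum q y x al e M L k i (b + p.1) p.2) := by
  induction L generalizing al e b c with
  | zero =>
    obtain ⟨rfl, rfl⟩ : b = 0 ∧ c = 0 := by simp at hb; omega
    simp [twoRowSum, rowSum, pathSum, hRatio]
  | succ L ih =>
    rcases lt_or_ge (b + c + i 0) (k 0) with h | h
    · rw [twoRowSum_succ_eq_zero _ _ _ _ _ _ _ _ _ _ h, mul_zero, Finset.sum_eq_zero]
      intro p hp
      rw [Finset.HasAntidiagonal.mem_antidiagonal] at hp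
      rw [twoRowSum_succ_eq_zero _ _ _ _ _ _ _ _ _ _ (by omega), mul_zero, mul_zero]
    obtain ⟨s, hs⟩ := Nat.exists_eq_add_of_le h
    set Z := twoRowSum q y x (fun j => al (j + 1)) (fun j => e (j + 1)) M L (Fin.tail k)
      (Fin.tail i) with hZ
    -- The factor `hRatio q y (e 2)` released by the first column is the one the induction
    -- hypothesis needs for the remaining columns. After applying it, the terms are regrouped by the
    -- new labels to the right of the first column.
    have hL : twoRowSum q x y al e M (L + 1) k i b c =
        ∑ p ∈ Finset.HasAntidiagonal.antidiagonal s,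
          (∑ r ∈ Finset.HasAntidiagonal.antidiagonal p.1,
            pairWeight q x y (al 0) (e 0) (e 1) c (k 0) (i 0) r.1 (p.2 + r.2)
              * hRatio q y x r.2) * (hRatio q x (e 2) p.2 * Z p.1 p.2) := by
      have h1 := sum_antidiagonal_antidiagonal (fun b' d c' =>
        pairWeight q x y (al 0) (e 0) (e 1) c (k 0) (i 0) b' (c' + d) * hRatio q y x d
          * (hRatio q x (e 2) c' * Z (b' + d) c')) s
      have h2 : ∀ p ∈ Finset.HasAntidiagonal.antidiagonal s,
          ∑ r ∈ Finset.HasAntidiagonal.antidiagonal p.1,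
            pairWeight q x y (al 0) (e 0) (e 1) c (k 0) (i 0) r.1 (p.2 + r.2) * hRatio q y x r.2
              * (hRatio q x (e 2) p.2 * Z (r.1 + r.2) p.2) =
          (∑ r ∈ Finset.HasAntidiagonal.antidiagonal p.1,
            pairWeight q x y (al 0) (e 0) (e 1) c (k 0) (i 0) r.1 (p.2 + r.2)
              * hRatio q y x r.2) * (hRatio q x (e 2) p.2 * Z p.1 p.2) := by
        intro p _
        rw [Finset.sum_mul]
        refine Finset.sum_congr rfl fun r hr => ?_
        rw [Finset.HasAntidiagonal.mem_antidiagonal.1 hr]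
      rw [twoRowSum_succ_eq_sum_antidiagonal _ _ _ _ _ _ _ _ _ _ _ hs hk hb,
        ← Finset.sum_congr rfl h2, ← h1]
      refine Finset.sum_congr rfl fun p hp => ?_
      rw [Finset.HasAntidiagonal.mem_antidiagonal] at hp
      rw [Fin.sum_univ_succ] at hk
      rw [Fin.sum_univ_succ, Fin.sum_univ_succ] at hb
      rw [ih (fun j => al (j + 1)) (fun j => e (j + 1)) (fun j hj => hne (j + 1) (by omega))
        (Fin.tail k) (Fin.tail i) p.1 p.2 (by simp only [Fin.tail]; omega)
        (by simp only [Fin.tail]; omega), Finset.mul_sum]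
      refine Finset.sum_congr rfl fun r hr => ?_
      rw [Finset.HasAntidiagonal.mem_antidiagonal] at hr
      rw [add_comm r.2, hr, mul_assoc]
    have hR : ∀ p ∈ Finset.HasAntidiagonal.antidiagonal c,
        twoRowSum q y x al e M (L + 1) k i (b + p.1) p.2 =
        ∑ r ∈ Finset.HasAntidiagonal.antidiagonal s,
          pairWeight q y x (al 0) (e 0) (e 1) p.2 (k 0) (i 0) r.1 r.2
            * (hRatio q x (e 2) r.2 * Z r.1 r.2) := by
      intro p hp
      rw [Finset.HasAntidiagonal.mem_antidiagonal] at hp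
      exact twoRowSum_succ_eq_sum_antidiagonal _ _ _ _ _ _ _ _ _ _ _ (by omega) hk (by omega)
    rw [hL, Finset.mul_sum]
    symm
    rw [Finset.sum_congr rfl fun p hp => by
      rw [hR p hp, Finset.mul_sum, Finset.mul_sum], Finset.sum_comm]
    refine Finset.sum_congr rfl fun p _ => ?_
    symm
    -- What remains is the exchange within the first column, for each fixed pair of labels on its
    -- right.
    rw [← mul_assoc, pairWeight_exchange hq _ _ _ _ _ (hne 0 (by omega)), Finset.sum_mul]
    exact Finset.sum_congr rfl fun r _ => by ring

/-! ### Commutation of row kernels. -/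

/-- The partition function of a row with right label `0`, summed over the left label with the
boundary weights. -/
noncomputable def rowKernel (q κ α₀ : ℂ) (al e : ℕ → ℂ) (M L : ℕ) (k m : Fin L → ℕ) : ℂ :=
  ∑ h ∈ Finset.range (M + 1), α₀ ^ h * hRatio q κ (e 0) h * rowSum q κ al e M L k m h

theorem rowKernel_conservation (κ α₀ : ℂ) (al e : ℕ → ℂ) (M L : ℕ) (k m : Fin L → ℕ)
    (hne : rowKernel q κ α₀ al e M L k m ≠ 0) : ∑ c, m c ≤ ∑ c, k c := by
  obtain ⟨h, -, hh⟩ := Finset.exists_ne_zero_of_sum_ne_zero hne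
  have := rowSum_conservation _ _ _ _ _ _ _ _ (right_ne_zero_of_mul hh)
  omega

theorem sum_rowKernel_mul_rowKernel (x y α₀ : ℂ) (al e : ℕ → ℂ) (M L : ℕ) (k i : Fin L → ℕ) :
    ∑ m ∈ Fintype.piFinset (fun _ : Fin L => Finset.range (M + 1)),
        rowKernel q x α₀ al e M L k m * rowKernel q y α₀ al (fun j => e (j + 1)) M L m i =
      ∑ p ∈ Finset.range (M + 1) ×ˢ Finset.range (M + 1),
        α₀ ^ (p.1 + p.2) * (hRatio q x (e 0) p.1 * (hRatio q y (e 1) p.2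
          * twoRowSum q x y al e M L k i p.1 p.2)) := by
  rw [Finset.sum_product]
  simp only [rowKernel, Finset.sum_mul_sum]
  rw [Finset.sum_comm]
  refine Finset.sum_congr rfl fun _ _ => ?_
  rw [Finset.sum_comm]
  simp only [twoRowSum, Finset.mul_sum]
  refine Finset.sum_congr rfl fun _ _ => Finset.sum_congr rfl fun _ _ => ?_
  rw [pow_add]
  ring

theorem sum_rowKernel_eq_sum_antidiagonal (x y α₀ : ℂ) (al e : ℕ → ℂ) (M L : ℕ)
    (k i : Fin L → ℕ) (s : ℕ) (hs : s + ∑ j, i j = ∑ j, k j) (hk : ∑ j, k j ≤ M) :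
    ∑ m ∈ Fintype.piFinset (fun _ : Fin L => Finset.range (M + 1)),
        rowKernel q x α₀ al e M L k m * rowKernel q y α₀ al (fun j => e (j + 1)) M L m i =
      α₀ ^ s * ∑ p ∈ Finset.HasAntidiagonal.antidiagonal s,
        hRatio q x (e 0) p.1 * (hRatio q y (e 1) p.2
          * twoRowSum q x y al e M L k i p.1 p.2) := by
  rw [sum_rowKernel_mul_rowKernel, Finset.mul_sum]
  symm
  refine Finset.sum_subset_zero_on_sdiff ?_ ?_ ?_
  · rintro ⟨b, c⟩ hp
    rw [Finset.HasAntidiagonal.mem_antidiagonal] at hp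
    simp only [Finset.mem_product, Finset.mem_range]
    simp only at hp
    omega
  · rintro ⟨b, c⟩ hp
    simp only [Finset.mem_sdiff, Finset.HasAntidiagonal.mem_antidiagonal] at hp
    by_contra hne
    have := twoRowSum_conservation _ _ _ _ _ _ _ _ _ _
      (right_ne_zero_of_mul (right_ne_zero_of_mul (right_ne_zero_of_mul hne)))
    omega
  · rintro ⟨b, c⟩ hp
    rw [Finset.HasAntidiagonal.mem_antidiagonal] at hp
    rw [hp]

/-- The kernels of two adjacent rows commute, in the sense that their composition is symmetric
in the parameters of the rows. -/
theorem rowKernel_comm (hq : ∀ m : ℕ, 1 ≤ m → q ^ m ≠ 1) (x y α₀ : ℂ) (al e : ℕ → ℂ) (M L : ℕ)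
    (hne : ∀ j < L, ∀ m, qPoch (e (j + 1) * al j) q m ≠ 0) (k i : Fin L → ℕ)
    (hk : ∑ j, k j ≤ M) :
    ∑ m ∈ Fintype.piFinset (fun _ : Fin L => Finset.range (M + 1)),
        rowKernel q x α₀ al e M L k m * rowKernel q y α₀ al (fun j => e (j + 1)) M L m i =
      ∑ m ∈ Fintype.piFinset (fun _ : Fin L => Finset.range (M + 1)),
        rowKernel q y α₀ al e M L k m * rowKernel q x α₀ al (fun j => e (j + 1)) M L m i := by
  rcases lt_or_ge (∑ j, k j) (∑ j, i j) with h | h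
  · have h0 : ∀ x y : ℂ, ∑ m ∈ Fintype.piFinset (fun _ : Fin L => Finset.range (M + 1)),
        rowKernel q x α₀ al e M L k m * rowKernel q y α₀ al (fun j => e (j + 1)) M L m i = 0 := by
      intro x y
      refine Finset.sum_eq_zero fun m _ => ?_
      by_contra hne
      have h1 := rowKernel_conservation _ _ _ _ _ _ _ _ (left_ne_zero_of_mul hne)
      have h2 := rowKernel_conservation _ _ _ _ _ _ _ _ (right_ne_zero_of_mul hne)
      omega
    rw [h0, h0]
  obtain ⟨s, hs⟩ := Nat.exists_eq_add_of_le' h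
  rw [sum_rowKernel_eq_sum_antidiagonal _ _ _ _ _ _ _ _ _ _ hs.symm hk,
    sum_rowKernel_eq_sum_antidiagonal _ _ _ _ _ _ _ _ _ _ hs.symm hk]
  congr 1
  -- Here `d` is the amount moved to the upper row. Regrouping by `b + d` isolates a `q`-Vandermonde
  -- sum, which turns the upper boundary factor from the one for `x` into the one for `y`.
  have h1 := sum_antidiagonal_antidiagonal (fun b d c =>
    hRatio q x (e 0) b * (hRatio q y x d * (hRatio q x (e 1) c
      * twoRowSum q y x al e M L k i (b + d) c))) s
  have h2 : ∀ p ∈ Finset.HasAntidiagonal.antidiagonal s,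
      hRatio q x (e 0) p.1 * (hRatio q y (e 1) p.2 * twoRowSum q x y al e M L k i p.1 p.2) =
      ∑ r ∈ Finset.HasAntidiagonal.antidiagonal p.2, hRatio q x (e 0) p.1 *
        (hRatio q y x r.1 * (hRatio q x (e 1) r.2
          * twoRowSum q y x al e M L k i (p.1 + r.1) r.2)) := by
    intro p hp
    rw [Finset.HasAntidiagonal.mem_antidiagonal] at hp
    rw [twoRowSum_exchange hq x y al e M L hne k i p.1 p.2 hk (by omega), Finset.mul_sum]
  rw [Finset.sum_congr rfl h2, h1]
  refine Finset.sum_congr rfl fun p _ => ?_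
  have h3 : ∑ r ∈ Finset.HasAntidiagonal.antidiagonal p.1,
      hRatio q x (e 0) r.1 * hRatio q y x r.2 = hRatio q y (e 0) p.1 :=
    sum_hPoch_mul_hPoch hq x y (e 0) p.1
  rw [← h3, Finset.sum_mul]
  refine Finset.sum_congr rfl fun r hr => ?_
  rw [Finset.HasAntidiagonal.mem_antidiagonal.1 hr, mul_assoc]

end TwoRows
-- From adjacent transpositions to all permutations.
section Symmetry

variable {ι : Type*}

/-- Only the composition of the steps `p` and `p + 1` matters. The first of these is compared only
at starting points in `S`, which suffices because every path stays in `S`. -/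
theorem pathSum_congr_of_adjacent (S : Finset ι) (n : ℕ) (w w' : Fin (n + 1) → ι → ι → ℂ)
    (p : Fin n)
    (hp : ∀ x ∈ S, ∀ z, ∑ y ∈ S, w p.castSucc x y * w p.succ y z =
      ∑ y ∈ S, w' p.castSucc x y * w' p.succ y z)
    (hne : ∀ r, r ≠ p.castSucc → r ≠ p.succ → w r = w' r) (g : ι → ℂ) (x : ι) (hx : x ∈ S) :
    pathSum S (n + 1) w g x = pathSum S (n + 1) w' g x := by
  induction n generalizing x with
  | zero => exact p.elim0
  | succ n ih =>
    induction p using Fin.cases with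
    | zero =>
      have h : (fun c : Fin n => w c.succ.succ) = fun c => w' c.succ.succ := by
        funext c
        refine hne _ (Fin.succ_ne_zero _) fun h => ?_
        exact Fin.succ_ne_zero c (Fin.succ_injective _ h)
      simp only [pathSum, Finset.mul_sum, h, ← mul_assoc]
      rw [Finset.sum_comm]
      conv_rhs => rw [Finset.sum_comm]
      refine Finset.sum_congr rfl fun z _ => ?_
      rw [← Finset.sum_mul, ← Finset.sum_mul]
      exact congrArg (· * _) (hp x hx z)
    | succ p =>
      rw [pathSum, pathSum, hne 0 (by simp [Fin.ext_iff]) (by simp [Fin.ext_iff])]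
      refine Finset.sum_congr rfl fun y hy => congrArg _ ?_
      refine ih _ _ p hp (fun r h1 h2 => hne _ ?_ ?_) y hy
      · rw [← Fin.succ_castSucc]
        exact fun h => h1 (Fin.succ_injective _ h)
      · exact fun h => h2 (Fin.succ_injective _ h)

/-- The labels of `L` parallel edges with total at most `M`. -/
noncomputable def boundedLabels (M L : ℕ) : Finset (Fin L → ℕ) :=
  (Fintype.piFinset fun _ : Fin L => Finset.range (M + 1)).filter fun m => ∑ c, m c ≤ M

theorem mem_boundedLabels {M L : ℕ} {m : Fin L → ℕ} : m ∈ boundedLabels M L ↔ ∑ c, m c ≤ M := by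
  simp only [boundedLabels, Finset.mem_filter, Fintype.mem_piFinset, Finset.mem_range,
    and_iff_right_iff_imp]
  intro h c
  have := Finset.single_le_sum (f := m) (fun _ _ => Nat.zero_le _) (Finset.mem_univ c)
  omega

variable {q : ℂ}

/-- The partition function of `n` rows with top labels `k`, where `g` is the weight of the bottom
labels. -/
noncomputable def multiRow (q α₀ : ℂ) (al e : ℕ → ℂ) (M L n : ℕ) (g : (Fin L → ℕ) → ℂ)
    (k : Fin L → ℕ) (κ : Fin n → ℂ) : ℂ :=
  pathSum (boundedLabels M L) n
    (fun r => rowKernel q (κ r) α₀ al (fun j => e (r + j)) M L) g k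

/-- A row never increases the total of the vertical labels from top to bottom, so the bound on the
total, which the commutation needs at every level, is inherited from the top. -/
theorem sum_boundedLabels_rowKernel (x y α₀ : ℂ) (al e e' : ℕ → ℂ) (M L : ℕ) (k i : Fin L → ℕ)
    (hk : k ∈ boundedLabels M L) :
    ∑ m ∈ boundedLabels M L, rowKernel q x α₀ al e M L k m * rowKernel q y α₀ al e' M L m i =
      ∑ m ∈ Fintype.piFinset (fun _ : Fin L => Finset.range (M + 1)),
        rowKernel q x α₀ al e M L k m * rowKernel q y α₀ al e' M L m i :=
  Finset.sum_filter_of_ne fun _ _ h =>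
    (rowKernel_conservation _ _ _ _ _ _ _ _ (left_ne_zero_of_mul h)).trans
      (mem_boundedLabels.1 hk)

theorem multiRow_comp_swap (hq : ∀ m : ℕ, 1 ≤ m → q ^ m ≠ 1) (α₀ : ℂ) (al e : ℕ → ℂ)
    (M L n : ℕ) (hne : ∀ r < n, ∀ j < L, ∀ m, qPoch (e (r + (j + 1)) * al j) q m ≠ 0)
    (g : (Fin L → ℕ) → ℂ) (k : Fin L → ℕ) (hk : k ∈ boundedLabels M L) (κ : Fin (n + 1) → ℂ)
    (p : Fin n) :
    multiRow q α₀ al e M L (n + 1) g k (κ ∘ Equiv.swap p.castSucc p.succ) =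
      multiRow q α₀ al e M L (n + 1) g k κ := by
  refine pathSum_congr_of_adjacent _ _ _ _ p (fun x hx z => ?_) (fun r h1 h2 => ?_) _ _ hk
  -- The parameters of the next row are those of the current row shifted by one column.
  · have h3 : (fun j => e ((p.succ : Fin (n + 1)) + j)) = fun j => e (p.castSucc + (j + 1)) := by
      funext j
      simp [add_assoc, add_comm 1]
    have h4 := rowKernel_comm hq (κ p.succ) (κ p.castSucc) α₀ al (fun j => e (p.castSucc + j)) M L
      (hne p p.2) x z (mem_boundedLabels.1 hx)
    rw [h3, sum_boundedLabels_rowKernel _ _ _ _ _ _ _ _ _ _ hx,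
      sum_boundedLabels_rowKernel _ _ _ _ _ _ _ _ _ _ hx]
    simpa using h4
  · simp [Equiv.swap_apply_of_ne_of_ne h1 h2]

theorem multiRow_comp_perm (hq : ∀ m : ℕ, 1 ≤ m → q ^ m ≠ 1) (α₀ : ℂ) (al e : ℕ → ℂ)
    (M L n : ℕ) (hne : ∀ r < n, ∀ j < L, ∀ m, qPoch (e (r + (j + 1)) * al j) q m ≠ 0)
    (g : (Fin L → ℕ) → ℂ) (k : Fin L → ℕ) (hk : k ∈ boundedLabels M L) (κ : Fin n → ℂ)
    (σ : Equiv.Perm (Fin n)) :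
    multiRow q α₀ al e M L n g k (κ ∘ σ) = multiRow q α₀ al e M L n g k κ := by
  cases n with
  | zero => rw [Subsingleton.elim (κ ∘ σ) κ]
  | succ n =>
    -- Adjacent transpositions generate the symmetric group even as a monoid, so inverses need no
    -- separate case.
    have hσ : σ ∈ Submonoid.closure
        (Set.range fun i : Fin n => Equiv.swap i.castSucc i.succ) := by
      rw [Equiv.Perm.mclosure_swap_castSucc_succ]
      trivial
    induction hσ using Submonoid.closure_induction generalizing κ with
    | mem σ h =>
      obtain ⟨p, rfl⟩ := h
      exact multiRow_comp_swap hq α₀ al e M L n (fun r hr => hne r (by omega)) g k hk κ p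
    | one => rfl
    | mul σ τ _ _ h1 h2 =>
      rw [Equiv.Perm.coe_mul, ← Function.comp_assoc, h2, h1]

end Symmetry

/-! ### Polynomial dependence on the variables. -/

section Polynomial

variable {q : ℂ} {n : ℕ}

/-- The algebra of polynomial functions on `ℂⁿ`. -/
noncomputable def polyFun (n : ℕ) : Subalgebra ℂ ((Fin n → ℂ) → ℂ) :=
  (MvPolynomial.aeval fun (r : Fin n) (κ : Fin n → ℂ) => κ r :
    MvPolynomial (Fin n) ℂ →ₐ[ℂ] ((Fin n → ℂ) → ℂ)).range

theorem exists_eval_of_mem_polyFun {f : (Fin n → ℂ) → ℂ} (hf : f ∈ polyFun n) :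
    ∃ P : MvPolynomial (Fin n) ℂ, ∀ κ, MvPolynomial.eval κ P = f κ := by
  obtain ⟨P, rfl⟩ := hf
  refine ⟨P, fun κ => ?_⟩
  induction P using MvPolynomial.induction_on with
  | C a => simp
  | add P Q hP hQ => simp [hP, hQ]
  | mul_X P r hP => simp [hP]

theorem const_mem_polyFun (a : ℂ) : (fun _ => a) ∈ polyFun n :=
  (polyFun n).algebraMap_mem a

theorem coord_mem_polyFun (r : Fin n) : (fun κ => κ r) ∈ polyFun n :=
  ⟨MvPolynomial.X r, by simp⟩

theorem mul_mem_polyFun {f g : (Fin n → ℂ) → ℂ} (hf : f ∈ polyFun n) (hg : g ∈ polyFun n) :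
    (fun κ => f κ * g κ) ∈ polyFun n := (polyFun n).mul_mem hf hg

theorem sub_mem_polyFun {f g : (Fin n → ℂ) → ℂ} (hf : f ∈ polyFun n) (hg : g ∈ polyFun n) :
    (fun κ => f κ - g κ) ∈ polyFun n := (polyFun n).sub_mem hf hg

theorem sum_mem_polyFun {ι : Type*} (S : Finset ι) {f : ι → (Fin n → ℂ) → ℂ}
    (hf : ∀ i ∈ S, f i ∈ polyFun n) : (fun κ => ∑ i ∈ S, f i κ) ∈ polyFun n := by
  convert (polyFun n).sum_mem hf using 1
  ext κ
  simp

theorem prod_mem_polyFun {ι : Type*} (S : Finset ι) {f : ι → (Fin n → ℂ) → ℂ}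
    (hf : ∀ i ∈ S, f i ∈ polyFun n) : (fun κ => ∏ i ∈ S, f i κ) ∈ polyFun n := by
  convert (polyFun n).prod_mem hf using 1
  ext κ
  simp

theorem hRatio_mem_polyFun (r : Fin n) (y : ℂ) (m : ℕ) :
    (fun κ => hRatio q (κ r) y m) ∈ polyFun n := by
  simp only [hRatio, div_eq_mul_inv]
  exact mul_mem_polyFun (prod_mem_polyFun _ fun i _ =>
    sub_mem_polyFun (coord_mem_polyFun r) (const_mem_polyFun _)) (const_mem_polyFun _)

theorem qPoch_mem_polyFun (r : Fin n) (α : ℂ) (m : ℕ) :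
    (fun κ => qPoch (α * κ r) q m) ∈ polyFun n :=
  prod_mem_polyFun _ fun _ _ => sub_mem_polyFun (const_mem_polyFun _)
    (mul_mem_polyFun (mul_mem_polyFun (const_mem_polyFun _) (coord_mem_polyFun r))
      (const_mem_polyFun _))

theorem rowWeight_mem_polyFun (r : Fin n) (α A β : ℂ) (m k h h' : ℕ) :
    (fun κ => rowWeight q (κ r) α A β m k h h') ∈ polyFun n := by
  unfold rowWeight
  split_ifs
  · simp only [div_eq_mul_inv]
    exact mul_mem_polyFun (mul_mem_polyFun (mul_mem_polyFun (const_mem_polyFun _)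
      (hRatio_mem_polyFun r β h')) (mul_mem_polyFun (qPoch_mem_polyFun r α _)
      (const_mem_polyFun _))) (const_mem_polyFun _)
  · exact const_mem_polyFun 0

theorem pathSum_mem_polyFun {ι : Type*} (S : Finset ι) (L : ℕ)
    (w : (Fin n → ℂ) → Fin L → ι → ι → ℂ) (hw : ∀ c x y, (fun κ => w κ c x y) ∈ polyFun n)
    (g : ι → ℂ) (x : ι) : (fun κ => pathSum S L (w κ) g x) ∈ polyFun n := by
  induction L generalizing x with
  | zero => exact const_mem_polyFun _
  | succ L ih =>
    exact sum_mem_polyFun _ fun y _ => mul_mem_polyFun (hw 0 x y)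
      (ih (fun κ c => w κ c.succ) (fun c => hw c.succ) y)

theorem multiRow_mem_polyFun (α₀ : ℂ) (al e : ℕ → ℂ) (M L : ℕ) (g : (Fin L → ℕ) → ℂ)
    (k : Fin L → ℕ) : multiRow q α₀ al e M L n g k ∈ polyFun n :=
  pathSum_mem_polyFun _ _ _ (fun r _ _ => sum_mem_polyFun _ fun _ _ =>
    mul_mem_polyFun (mul_mem_polyFun (const_mem_polyFun _) (hRatio_mem_polyFun r _ _))
      (pathSum_mem_polyFun _ _ _ (fun _ _ _ => rowWeight_mem_polyFun r _ _ _ _ _ _ _) _ _)) _ _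

/-- Over the infinite field `ℂ` a polynomial is determined by its values, so invariance of the
function gives invariance of the polynomial. -/
theorem exists_isSymmetric_of_mem_polyFun {f : (Fin n → ℂ) → ℂ} (hf : f ∈ polyFun n)
    (hsymm : ∀ κ (σ : Equiv.Perm (Fin n)), f (κ ∘ σ) = f κ) :
    ∃ P : MvPolynomial (Fin n) ℂ, P.IsSymmetric ∧ ∀ κ, MvPolynomial.eval κ P = f κ := by
  obtain ⟨P, hP⟩ := exists_eval_of_mem_polyFun hf
  refine ⟨P, fun σ => MvPolynomial.funext fun κ => ?_, hP⟩
  rw [MvPolynomial.eval_rename, hP, hP, hsymm]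

end Polynomial
-- Identification of the spin `q`-Whittaker function with `multiRow`.
theorem Ptn.part_eq_zero (lam : Ptn) {c : ℕ} (h : lam.length ≤ c) : lam.part c = 0 := by
  by_contra hne
  have hsub : (↑(Finset.range (c + 1)) : Set ℕ) ⊆ Function.support lam.part := fun j hj => by
    have := lam.antitone_part (Nat.lt_succ_iff.1 (Finset.mem_range.1 hj))
    rw [Function.mem_support]
    omega
  have := Set.ncard_le_ncard hsub lam.finite_support
  rw [Set.ncard_coe_finset, Finset.card_range] at this
  rw [Ptn.length] at h
  omega

theorem Ptn.sum_mult_add (lam : Ptn) (L : ℕ) :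
    ∑ c ∈ Finset.range L, lam.mult c + lam.part L = lam.part 0 := by
  induction L with
  | zero => simp
  | succ L ih =>
    have : lam.part (L + 1) ≤ lam.part L := lam.antitone_part (Nat.le_succ L)
    rw [Finset.sum_range_succ, Ptn.mult]
    omega

theorem Ptn.sum_mult (lam : Ptn) {L : ℕ} (h : lam.length ≤ L) :
    ∑ c : Fin L, lam.mult c = lam.part 0 := by
  have := lam.sum_mult_add L
  rwa [lam.part_eq_zero h, add_zero, ← Fin.sum_univ_eq_sum_range] at this

theorem cFactor_eq (q : ℂ) (s : ℕ → ℂ) (lam : Ptn) {L : ℕ} (h : lam.length ≤ L) :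
    cFactor q s lam =
      ∏ c : Fin L, qPoch (s (c + 1) ^ 2) q (lam.mult c) / qPoch q q (lam.mult c) := by
  rw [Fin.prod_univ_eq_prod_range
    (fun c => qPoch (s (c + 1) ^ 2) q (lam.mult c) / qPoch q q (lam.mult c)), cFactor]
  refine Finset.prod_subset (Finset.range_mono h) fun c _ hc => ?_
  have hm : lam.mult c = 0 := by
    rw [Ptn.mult, lam.part_eq_zero (by simpa using hc), Nat.zero_sub]
  simp [hm]

theorem Config.conservation {n L : ℕ} {C : Config n L} {q : ℂ} {xi s rxi rs : ℕ → ℂ}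
    {kappa : Fin n → ℂ} (hw : C.totalWeight q xi s rxi rs kappa ≠ 0) (r : Fin n) (c : Fin L) :
    C.ver r.succ c + C.hor r c.castSucc = C.ver r.castSucc c + C.hor r c.succ := by
  by_contra hne
  apply hw
  refine Finset.prod_eq_zero (Finset.mem_univ r) (Finset.prod_eq_zero (Finset.mem_univ c) ?_)
  simp [weight, hne]

/-- Everything follows from conservation, started at the top, where the labels add up to `λ_1`. At
the bottom it yields the constraint on the left labels. -/
theorem Config.bounds {n L : ℕ} {C : Config n L} {q : ℂ} {xi s rxi rs : ℕ → ℂ}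
    {kappa : Fin n → ℂ} {a : Fin n → ℕ} {lam mu : Ptn} (hlam : lam.length ≤ L)
    (hmu : mu.length ≤ L) (hb : C.HasBoundary a lam mu)
    (hw : C.totalWeight q xi s rxi rs kappa ≠ 0) :
    (∀ r c, C.hor r c ≤ lam.part 0) ∧ (∀ r, ∑ c, C.ver r c ≤ lam.part 0) ∧
      ∑ r, a r + mu.part 0 = lam.part 0 := by
  have hrow := fun r => row_conservation (C.hor r) (C.ver r.castSucc) (C.ver r.succ)
    (Config.conservation hw r)
  have hlast : ∀ r, a r + ∑ c, C.ver r.succ c = ∑ c, C.ver r.castSucc c := by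
    intro r
    simpa [hb.left, hb.right, Fin.castSucc_lt_last] using hrow r (Fin.last L)
  have hv : ∀ r : Fin (n + 1), ∑ c, C.ver r c + ∑ r' : Fin n with r'.castSucc < r, a r' =
      lam.part 0 := by
    intro r
    induction r using Fin.induction with
    | zero => simp [hb.top, lam.sum_mult hlam]
    | succ r ih =>
      have e : (Finset.univ.filter fun c : Fin n => c.castSucc < r.succ) =
          insert r (Finset.univ.filter fun c : Fin n => c.castSucc < r.castSucc) := by
        ext c
        simp only [Finset.mem_filter, Finset.mem_univ, true_and, Finset.mem_insert,
          Fin.lt_def, Fin.val_castSucc, Fin.val_succ, Fin.ext_iff]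
        omega
      rw [e, Finset.sum_insert (by simp)]
      have := hlast r
      omega
  refine ⟨fun r c => ?_, fun r => ?_, ?_⟩
  · have h1 := hrow r c
    have h2 : ∑ c' : Fin L with c'.castSucc < c, C.ver r.succ c' ≤ ∑ c', C.ver r.succ c' :=
      Finset.sum_le_sum_of_subset (Finset.filter_subset _ _)
    have h3 := hlast r
    have h4 := hv r.castSucc
    have h5 := hb.left r
    omega
  · have := hv r
    omega
  · have := hv (Fin.last n)
    simp only [Fin.castSucc_lt_last, Finset.filter_true, hb.bottom, mu.sum_mult hmu] at this
    omega

/-- The finite set of pairs of horizontal and vertical labels to which the configurations with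
nonzero weight belong. -/
noncomputable def labelBox (M n L : ℕ) :
    Finset ((Fin n → Fin (L + 1) → ℕ) × (Fin (n + 1) → Fin L → ℕ)) :=
  (Fintype.piFinset fun _ : Fin n => Fintype.piFinset fun _ : Fin (L + 1) =>
    Finset.range (M + 1)) ×ˢ Fintype.piFinset fun _ : Fin (n + 1) => boundedLabels M L

open Classical in
theorem partitionFunction_eq_sum (q : ℂ) (xi s rxi rs : ℕ → ℂ) {n L : ℕ} (a : Fin n → ℕ)
    (lam mu : Ptn) (kappa : Fin n → ℂ) (hlam : lam.length ≤ L) (hmu : mu.length ≤ L) :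
    partitionFunction q xi s rxi rs L a lam mu kappa =
      ∑ p ∈ labelBox (lam.part 0) n L,
        if (Config.mk p.1 p.2).HasBoundary a lam mu then
          (Config.mk p.1 p.2).totalWeight q xi s rxi rs kappa else 0 := by
  rw [partitionFunction]
  simp only [finsum_eq_if]
  rw [finsum_eq_sum_of_support_subset
    (s := (labelBox (lam.part 0) n L).image fun p => Config.mk p.1 p.2)]
  · refine Finset.sum_image fun p _ p' _ h => ?_
    obtain ⟨h1, h2⟩ := Config.mk.inj h
    exact Prod.ext h1 h2
  · intro C hC
    obtain ⟨hb, hw⟩ := ite_ne_right_iff.1 (Function.mem_support.1 hC)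
    obtain ⟨h1, h2, -⟩ := Config.bounds hlam hmu hb hw
    simp only [Finset.coe_image, Set.mem_image, Finset.mem_coe, labelBox, Finset.mem_product,
      Fintype.mem_piFinset, Finset.mem_range, mem_boundedLabels]
    exact ⟨(C.hor, C.ver), ⟨fun r c => Nat.lt_succ_iff.2 (h1 r c), h2⟩, rfl⟩

-- The left labels are part of the configuration, so the two summations merge. The constraint on
-- their total holds automatically for configurations of nonzero weight.
open Classical in
theorem stochWhittaker_eq_sum (q : ℂ) (xi s rxi rs : ℕ → ℂ) {n : ℕ} (lam mu : Ptn)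
    (kappa : Fin n → ℂ) :
    stochWhittaker q xi s rxi rs lam mu kappa =
      ∑ p ∈ labelBox (lam.part 0) n (max lam.length mu.length + 1),
        if (Config.mk p.1 p.2).HasBoundary (fun r => p.1 r 0) lam mu then
          (∏ r : Fin n, (kappa r * s 0 / xi 0) ^ p.1 r 0
            * (qPoch ((kappa r)⁻¹ * s (r + 1) * xi (r + 1)) q (p.1 r 0) / qPoch q q (p.1 r 0)))
          * (Config.mk p.1 p.2).totalWeight q xi s rxi rs kappa else 0 := by
  have hlam : lam.length ≤ max lam.length mu.length + 1 := by omega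
  have hmu : mu.length ≤ max lam.length mu.length + 1 := by omega
  simp only [stochWhittaker, partitionFunction_eq_sum q xi s rxi rs _ lam mu kappa hlam hmu,
    Finset.mul_sum]
  rw [Finset.sum_comm]
  refine Finset.sum_congr rfl fun p _ => ?_
  by_cases hp : (Config.mk p.1 p.2).HasBoundary (fun r => p.1 r 0) lam mu ∧
    (Config.mk p.1 p.2).totalWeight q xi s rxi rs kappa ≠ 0
  · rw [Finset.sum_eq_single fun r => p.1 r 0]
    · rw [if_pos hp.1, if_pos hp.1]
    · intro a _ ha
      rw [if_neg fun h => ha (funext fun r => (h.left r).symm), mul_zero]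
    · intro h
      obtain ⟨h1, -, h3⟩ := Config.bounds hlam hmu hp.1 hp.2
      refine absurd (Finset.mem_filter.2 ⟨Fintype.mem_piFinset.2 fun r => ?_, h3⟩) h
      exact Finset.mem_range.2 (Nat.lt_succ_iff.2 (h1 r 0))
  · have h0 : ∀ a : Fin n → ℕ, (if (Config.mk p.1 p.2).HasBoundary a lam mu then
        (Config.mk p.1 p.2).totalWeight q xi s rxi rs kappa else 0) = 0 := by
      intro a
      split_ifs with h
      · obtain rfl : (fun r => p.1 r 0) = a := funext h.left
        by_contra hw
        exact hp ⟨h, hw⟩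
      · rfl
    have h1 := h0 fun r => p.1 r 0
    simp only [h0, mul_zero, Finset.sum_const_zero]
    split_ifs at h1 ⊢
    · rw [h1, mul_zero]
    · rfl

theorem mixedShift_sq {xi s rxi rs : ℕ → ℂ} (hrxi : ∀ i, rxi i ^ 2 = xi i)
    (hrs : ∀ i, rs i ^ 2 = s i) (k i : ℕ) :
    mixedShift rs rxi k i ^ 2 = s (i + k) * xi (i + k) * s i / xi i := by
  rw [mixedShift, div_pow, mul_pow, mul_pow, hrs, hrs, hrxi, hrxi]

/-- Since `σ² / t² = α κ`, the powers of `κ` clear the denominators of `(η / κ; q)_{h'}`. The factor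
of the bottom edge cancels `(σ²; q)_m` and the `(q; q)_m` of the binomial, while `A` enters only
through the top edge. -/
theorem weight_mul_gauge {q κ α η t σ : ℂ} (hq : ∀ m : ℕ, 1 ≤ m → q ^ m ≠ 1) (hκ : κ ≠ 0)
    (hη : η ≠ 0) (ht : t ^ 2 = η / κ) (hσ : σ ^ 2 = η * α) (A : ℂ)
    (h1 : ∀ m, qPoch (η * α) q m ≠ 0) (m h k h' : ℕ) :
    weight q t σ m h k h' * (qPoch (η * α) q m / qPoch q q m / (qPoch (A * α) q k / qPoch q q k)) =
      rowWeight q κ α A η m k h h' := by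
  rw [weight, rowWeight]
  split_ifs
  swap
  · simp
  have n1 := mul_inv_cancel₀ (h1 m)
  have n2 := mul_inv_cancel₀ (qPoch_self_ne_zero hq m)
  have e1 : η * α / (η / κ) = α * κ := by field_simp
  have e2 : σ ^ (2 * h') * (t ^ (2 * h'))⁻¹ = α ^ h' * κ ^ h' := by
    rw [pow_mul, pow_mul, ht, hσ, ← div_eq_mul_inv, ← div_pow, e1, mul_pow]
  rw [e2, ht, hσ, e1, hRatio, ← pow_mul_qPoch_div hκ]
  simp only [div_eq_mul_inv, mul_inv, inv_inv]
  linear_combination (α ^ h' * κ ^ h' * qPoch (α * κ) q (m - h') * qPoch (η * κ⁻¹) q h'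
    * (qPoch q q (m - h'))⁻¹ * (qPoch q q h')⁻¹ * (qPoch (A * α) q k)⁻¹ * qPoch q q k) *
    (qPoch q q m * (qPoch q q m)⁻¹ * n1 + n2)

theorem prod_succ_div_castSucc {n : ℕ} (F : Fin (n + 1) → ℂ) (hF : ∀ r, F r ≠ 0) :
    ∏ r : Fin n, F r.succ / F r.castSucc = F (Fin.last n) / F 0 := by
  have h1 : ∏ r : Fin n, F r.castSucc ≠ 0 := Finset.prod_ne_zero_iff.2 fun r _ => hF _
  rw [Finset.prod_div_distrib, div_eq_div_iff h1 (hF 0), mul_comm, ← Fin.prod_univ_succ,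
    Fin.prod_univ_castSucc, mul_comm]

theorem rowKernel_eq_sum (q κ α₀ : ℂ) (al e : ℕ → ℂ) (M L : ℕ) (k m : Fin L → ℕ) :
    rowKernel q κ α₀ al e M L k m =
      ∑ h ∈ Fintype.piFinset fun _ : Fin (L + 1) => Finset.range (M + 1),
        α₀ ^ h 0 * hRatio q κ (e 0) (h 0)
          * (∏ c : Fin L, rowWeight q κ (al c) (e c) (e (c + 1)) (m c) (k c)
              (h c.castSucc) (h c.succ))
          * if h (Fin.last L) = 0 then 1 else 0 :=
  (sum_piFinset_eq_pathSum _ _ _ _ _).symm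

theorem multiRow_eq_sum (q α₀ : ℂ) (al e : ℕ → ℂ) (M L n : ℕ) (k i : Fin L → ℕ)
    (hk : k ∈ boundedLabels M L) (κ : Fin n → ℂ) :
    multiRow q α₀ al e M L n (fun m => if m = i then 1 else 0) k κ =
      ∑ p ∈ labelBox M n L,
        if (∀ r, p.1 r (Fin.last L) = 0) ∧ p.2 0 = k ∧ p.2 (Fin.last n) = i then
          ∏ r : Fin n, (α₀ ^ p.1 r 0 * hRatio q (κ r) (e r) (p.1 r 0) *
            ∏ c : Fin L, rowWeight q (κ r) (al c) (e (r + c)) (e (r + (c + 1)))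
              (p.2 r.succ c) (p.2 r.castSucc c) (p.1 r c.castSucc) (p.1 r c.succ))
        else 0 := by
  -- Summing over the starting point with an indicator brings the top level into the form required
  -- by `sum_piFinset_eq_pathSum`.
  have h1 : multiRow q α₀ al e M L n (fun m => if m = i then 1 else 0) k κ =
      ∑ x ∈ boundedLabels M L, (if x = k then 1 else 0) *
        multiRow q α₀ al e M L n (fun m => if m = i then 1 else 0) x κ := by
    rw [Finset.sum_eq_single k]
    · simp
    · intro x _ hx
      simp [hx]
    · exact fun h => absurd hk h
  rw [h1, labelBox, Finset.sum_product_right]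
  simp only [multiRow]
  rw [← sum_piFinset_eq_pathSum]
  refine Finset.sum_congr rfl fun v _ => ?_
  simp only [rowKernel_eq_sum]
  rw [Finset.prod_univ_sum, Finset.mul_sum, Finset.sum_mul]
  refine Finset.sum_congr rfl fun h _ => ?_
  split_ifs with h2 h3 h4 h4 h3 h4
  · simp [Finset.prod_mul_distrib, h4.1]
  · have : ¬∀ r, h r (Fin.last L) = 0 := fun h5 => h4 ⟨h5, h2, h3⟩
    push Not at this
    obtain ⟨r, hr⟩ := this
    rw [Finset.prod_eq_zero (Finset.mem_univ r) (by simp [hr])]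
    simp
  all_goals first | (exfalso; tauto) | simp

/-- The gauge factor of a vertical edge in row `r` and column `c` with label `m`. -/
noncomputable def gauge (q : ℂ) (xi s : ℕ → ℂ) (r c m : ℕ) : ℂ :=
  qPoch (xi (r + c + 1) * s (r + c + 1) * (s (c + 1) / xi (c + 1))) q m / qPoch q q m

theorem spinWhittaker_eq_multiRow (q : ℂ) (xi s rxi rs : ℕ → ℂ)
    (hrxi : ∀ i, rxi i ^ 2 = xi i) (hrs : ∀ i, rs i ^ 2 = s i)
    (hxi : ∀ i, xi i ≠ 0) (hs : ∀ i, s i ≠ 0) (n : ℕ)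
    (hq : ∀ m : ℕ, 1 ≤ m → q ^ m ≠ 1)
    (hne : ∀ r ≤ n, ∀ c m : ℕ,
      qPoch (xi (r + c + 1) * s (r + c + 1) * (s (c + 1) / xi (c + 1))) q m ≠ 0)
    (lam mu : Ptn) (kappa : Fin n → ℂ) (hκ : ∀ r, kappa r ≠ 0) :
    spinWhittaker q xi s rxi rs lam mu kappa =
      negPow (mixedShift rs rxi n) mu / negPow s lam *
        multiRow q (s 0 / xi 0) (fun c => s (c + 1) / xi (c + 1))
          (fun r => xi (r + 1) * s (r + 1)) (lam.part 0) (max lam.length mu.length + 1) n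
          (fun m => if m = fun c : Fin _ => mu.mult c then 1 else 0) (fun c => lam.mult c) kappa := by
  classical
  set L := max lam.length mu.length + 1 with hL
  have hlam : lam.length ≤ L := by omega
  have hmu : mu.length ≤ L := by omega
  have hk : (fun c : Fin L => lam.mult c) ∈ boundedLabels (lam.part 0) L :=
    mem_boundedLabels.2 (lam.sum_mult hlam).le
  rw [spinWhittaker, mul_assoc, stochWhittaker_eq_sum, multiRow_eq_sum _ _ _ _ _ _ _ _ _ hk,
    Finset.mul_sum]
  congr 1
  refine Finset.sum_congr rfl fun p _ => ?_
  have hg : ∀ r ≤ n, ∀ c m : ℕ, gauge q xi s r c m ≠ 0 := fun r hr c m =>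
    div_ne_zero (hne r hr c m) (qPoch_self_ne_zero hq m)
  by_cases hb : (∀ r, p.1 r (Fin.last L) = 0) ∧ p.2 0 = (fun c : Fin L => lam.mult c) ∧
    p.2 (Fin.last n) = fun c : Fin L => mu.mult c
  swap
  · rw [if_neg hb, if_neg, mul_zero]
    exact fun h => hb ⟨h.right, funext h.top, funext h.bottom⟩
  rw [if_pos hb, if_pos ⟨fun _ => rfl, hb.1, fun c => congrFun hb.2.1 c,
    fun c => congrFun hb.2.2 c⟩]
  -- The gauge ratios telescope over the rows. At `r = n` the argument is the square of the mixed
  -- shift, and at `r = 0` it is `s_{c+1}²`.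
  have hc : cFactor q (mixedShift rs rxi n) mu / cFactor q s lam =
      ∏ r : Fin n, ∏ c : Fin L,
        gauge q xi s (r + 1) c (p.2 r.succ c) / gauge q xi s r c (p.2 r.castSucc c) := by
    have h1 := prod_succ_div_castSucc
      (fun r : Fin (n + 1) => ∏ c : Fin L, gauge q xi s r c (p.2 r c))
      fun r => Finset.prod_ne_zero_iff.2 fun c _ => hg r (Nat.lt_succ_iff.1 r.2) _ _
    simp only [Fin.val_succ, Fin.val_castSucc, ← Finset.prod_div_distrib, Fin.val_last,
      Fin.val_zero] at h1
    rw [h1, cFactor_eq q _ mu hmu, cFactor_eq q s lam hlam, ← Finset.prod_div_distrib]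
    refine Finset.prod_congr rfl fun c _ => ?_
    rw [hb.2.1, hb.2.2, gauge, gauge, mixedShift_sq hrxi hrs]
    have e1 : s (↑c + 1 + n) * xi (↑c + 1 + n) * s (↑c + 1) / xi (↑c + 1) =
        xi (n + c + 1) * s (n + c + 1) * (s (c + 1) / xi (c + 1)) := by
      rw [show (c : ℕ) + 1 + n = n + c + 1 by omega]
      ring
    have e2 : s (↑c + 1) ^ 2 =
        xi (0 + c + 1) * s (0 + c + 1) * (s (c + 1) / xi (c + 1)) := by
      have := hxi (c + 1)
      rw [zero_add]
      field_simp
    rw [e1, e2]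
  rw [hc, Config.totalWeight, mul_left_comm, ← Finset.prod_mul_distrib,
    ← Finset.prod_mul_distrib]
  refine Finset.prod_congr rfl fun r _ => ?_
  rw [← Finset.prod_mul_distrib]
  congr 1
  · rw [hRatio, ← pow_mul_qPoch_div (hκ r), mul_div_assoc, mul_pow,
      show (kappa r)⁻¹ * s (r + 1) * xi (r + 1) = xi (r + 1) * s (r + 1) / kappa r by ring]
    ring
  · refine Finset.prod_congr rfl fun c _ => ?_
    rw [mul_comm, gauge, gauge]
    have e1 : (r : ℕ) + 1 + c + 1 = r + (c + 1) + 1 := by omega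
    have e2 : (r : ℕ) + 1 + (c + 1) = r + (c + 1) + 1 := by omega
    have e3 : (c : ℕ) + 1 + (r + 1) = r + (c + 1) + 1 := by omega
    have h1 := hne (r + 1) r.2 c
    rw [e1] at h1
    rw [e1, e2]
    -- The weight involves only `t²`, so all that is used of the complex square root is that it
    -- squares to its argument.
    refine weight_mul_gauge hq (hκ r) (mul_ne_zero (hxi _) (hs _)) (Complex.cpow_ofNat_inv_pow _ _) ?_ _ h1 _ _ _ _
    rw [mixedShift_sq hrxi hrs, e3]
    ring

end SpinQW

theorem mainTheorem1 (q : ℂ) (xi s rxi rs : ℕ → ℂ)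
    (hrxi : ∀ i, rxi i ^ 2 = xi i) (hrs : ∀ i, rs i ^ 2 = s i)
    (hxi : ∀ i, xi i ≠ 0) (hs : ∀ i, s i ≠ 0)
    (n : ℕ)
    (hq : ∀ m : ℕ, 1 ≤ m → q ^ m ≠ 1)
    (hgen : ∀ k ≤ n, ∀ i, 1 ≤ i → ∀ m : ℕ,
      s (i + k) * xi (i + k) * s i / xi i * q ^ m ≠ 1)
    (lam mu : SpinQW.Ptn) :
    ∃ P : MvPolynomial (Fin n) ℂ, P.IsSymmetric ∧
      ∀ kappa : Fin n → ℂ, (∀ r, kappa r ≠ 0) →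
        SpinQW.spinWhittaker q xi s rxi rs lam mu kappa = MvPolynomial.eval kappa P := by
  have hne : ∀ r ≤ n, ∀ c m : ℕ,
      SpinQW.qPoch (xi (r + c + 1) * s (r + c + 1) * (s (c + 1) / xi (c + 1))) q m ≠ 0 := by
    intro r hr c m
    refine Finset.prod_ne_zero_iff.2 fun j _ h => hgen r hr (c + 1) (by omega) j ?_
    rw [show c + 1 + r = r + c + 1 by omega]
    linear_combination -h
  set L := max lam.length mu.length + 1 with hL
  -- This expression is polynomial and symmetric on all of `ℂⁿ`; nonvanishing of the variables is
  -- needed only to compare it with the original function.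
  set f : (Fin n → ℂ) → ℂ := fun kappa =>
    SpinQW.negPow (SpinQW.mixedShift rs rxi n) mu / SpinQW.negPow s lam *
      SpinQW.multiRow q (s 0 / xi 0) (fun c => s (c + 1) / xi (c + 1))
        (fun r => xi (r + 1) * s (r + 1)) (lam.part 0) L n
        (fun m => if m = fun c : Fin _ => mu.mult c then 1 else 0) (fun c => lam.mult c) kappa with hf
  obtain ⟨P, hP, hPf⟩ := SpinQW.exists_isSymmetric_of_mem_polyFun (f := f)
    (SpinQW.mul_mem_polyFun (SpinQW.const_mem_polyFun _)
      (SpinQW.multiRow_mem_polyFun _ _ _ _ _ _ _))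
    fun κ σ => by
      rw [hf]
      refine congrArg _ (SpinQW.multiRow_comp_perm hq _ _ _ _ _ _ (fun r hr j _ m => ?_) _ _
        (SpinQW.mem_boundedLabels.2 (lam.sum_mult (by omega)).le) κ σ)
      have h := hne (r + 1) hr j m
      rwa [show r + 1 + j + 1 = r + (j + 1) + 1 by omega] at h
  refine ⟨P, hP, fun kappa hκ => ?_⟩
  rw [hPf, SpinQW.spinWhittaker_eq_multiRow q xi s rxi rs hrxi hrs hxi hs n hq hne lam mu kappa hκ]
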